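/- Let $k\ge 2$ and let $\Sigma=\{1,\dots,k\}^{\mathbb N}$ (with $0\in\mathbb N$) be the space of sequences $w=(w_r)_{r\ge 0}$ in the letters $1,\dots,k$, ordered lexicographically, with shift map $\sigma(w)_r=w_{r+1}$. A sequence $w\in\Sigma$ is called maximal if $\sigma^r(w)\le w$ for all $r\ge 0$. Let $$\Delta=\Big\{\alpha\in\mathbb R_{\ge 0}^k:\ \alpha_k>0,\ \textstyle\sum_i\alpha_i=1\Big\}.$$ For $\alpha\in\Delta$ let $\mathcal M(\alpha)$ be the set of maximal $w\in\Sigma$ such that, for each letter $i$, the proportion of the letter $i$ among $w_0,\dots,w_{r-1}$ tends to $\alpha_i$ as $r\to\infty$, and let $\mathcal{IM}(\alpha)=\inf\mathcal M(\alpha)$ be its infimum in $\Sigma$. For $\alpha\in\Delta$ put $J(\alpha)=\lfloor\alpha_1/\alpha_k\rfloor\in\mathbb N$, and define $K\colon\Delta\to\Delta$ by $$K(\alpha)=\left(\frac{\alpha_2}{1-\alpha_1},\dots,\frac{\alpha_{k-1}}{1-\alpha_1},\ \frac{\alpha_1-n\alpha_k}{1-\alpha_1},\ \frac{(n+1)\alpha_k-\alpha_1}{1-\alpha_1}\right),\qquad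 n=J(\alpha).$$ Let $\Phi\colon\Delta\to\mathbb N^{\mathbb N}$ be the itinerary map $\Phi(\alpha)_r=J(K^r(\alpha))$ for $r\ge 0$. Theorem. Let $\alpha\in\Delta$. Then (a) $\Phi^{-1}(\Phi(\alpha))\subset\Delta$ is a $d$-dimensional simplex (the convex hull of $d+1$ affinely independent points) for some $d$ with $0\le d\le k-2$; (b) $\mathcal{IM}(\alpha)$ is the minimum of $\mathcal M(\alpha)$ if and only if $\Phi^{-1}(\Phi(\alpha))$ is a single point. -/

import Mathlib

open Filter Topology

namespace Infimax

/-- Infinite sequences `w₀ w₁ w₂ …` over an ordered alphabet of `k` letters, ordered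
lexicographically. The letter called `i` (with `1 ≤ i ≤ k`) is the element `i - 1` of `Fin k`. -/
abbrev Seq (k : ℕ) : Type := Lex (ℕ → Fin k)

/-- The shift map `σ(w)ᵣ = wᵣ₊₁`. -/
def shift {k : ℕ} (w : Seq k) : Seq k := toLex fun r => ofLex w (r + 1)

/-- A sequence is maximal if it is at least as great as all of its shifts. -/
def IsMaximalSeq {k : ℕ} (w : Seq k) : Prop := ∀ r : ℕ, shift^[r] w ≤ w

/-- The vector of proportions of the letters among the first `r` letters of `w`
(meaningful for `r ≥ 1`; only its limit as `r → ∞` is used). -/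
noncomputable def proportions {k : ℕ} (w : Seq k) (r : ℕ) : Fin k → ℝ :=
  fun i => (((Finset.range r).filter fun s => ofLex w s = i).card : ℝ) / (r : ℝ)

/-- The sequences whose asymptotic proportions of letters are given by `α`. -/
def sequencesWithProportions {k : ℕ} (α : Fin k → ℝ) : Set (Seq k) :=
  {w | Tendsto (fun r : ℕ => proportions w r) atTop (𝓝 α)}

/-- The maximal sequences whose asymptotic proportions of letters are given by `α`. -/
def maximalSequences {k : ℕ} (α : Fin k → ℝ) : Set (Seq k) :=
  {w | IsMaximalSeq w} ∩ sequencesWithProportions α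

/-- In the lexicographic order, every set of sequences has an infimum. -/
theorem exists_isGLB {k : ℕ} [NeZero k] (S : Set (Seq k)) : ∃ w : Seq k, IsGLB S w := by
  classical
  rcases S.eq_empty_or_nonempty with rfl | hS
  · exact ⟨⊤, by simp⟩
  have hmin : ∀ (T : Set (Seq k)) (n : ℕ), ∃ i : Fin k,
      T.Nonempty → (∃ s ∈ T, ofLex s n = i) ∧ ∀ s ∈ T, i ≤ ofLex s n := by
    intro T n
    rcases T.eq_empty_or_nonempty with rfl | hT
    · exact ⟨0, fun h => absurd h (by simp)⟩
    obtain ⟨i, ⟨s, hs, rfl⟩, hi⟩ :=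
      Set.exists_min_image ((fun s : Seq k => ofLex s n) '' T) id (Set.toFinite _) (hT.image _)
    exact ⟨ofLex s n, fun _ => ⟨⟨s, hs, rfl⟩, fun t ht => hi _ ⟨t, ht, rfl⟩⟩⟩
  choose m hm using hmin
  -- the elements of `S` whose first `n` letters are successively least possible
  let T : ℕ → Set (Seq k) := fun n =>
    Nat.rec S (fun j U => {s | s ∈ U ∧ ofLex s j = m U j}) n
  have hT : ∀ n, T (n + 1) = {s | s ∈ T n ∧ ofLex s n = m (T n) n} := fun n => rfl
  have hne : ∀ n, (T n).Nonempty := by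
    intro n
    induction n with
    | zero => exact hS
    | succ n ih =>
      obtain ⟨s, hs, hsn⟩ := (hm (T n) n ih).1
      exact ⟨s, by rw [hT]; exact ⟨hs, hsn⟩⟩
  let w : Seq k := toLex fun n => m (T n) n
  have hagree : ∀ n s, s ∈ T n ↔ s ∈ S ∧ ∀ j < n, ofLex s j = ofLex w j := by
    intro n
    induction n with
    | zero => intro s; exact ⟨fun h => ⟨h, by simp⟩, fun h => h.1⟩
    | succ n ih =>
      intro s
      rw [hT]
      simp only [Set.mem_ofPred_eq, ih s, Nat.lt_succ_iff_lt_or_eq]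
      constructor
      · rintro ⟨⟨h1, h2⟩, h3⟩
        refine ⟨h1, ?_⟩
        rintro j (hj | rfl)
        · exact h2 j hj
        · exact h3
      · rintro ⟨h1, h2⟩
        exact ⟨⟨h1, fun j hj => h2 j (Or.inl hj)⟩, h2 n (Or.inr rfl)⟩
  refine ⟨w, ?_, ?_⟩
  · intro s hs
    by_contra hlt
    rw [not_le] at hlt
    obtain ⟨n, hn, hlt⟩ := hlt
    have : s ∈ T n := (hagree n s).2 ⟨hs, hn⟩
    exact absurd ((hm (T n) n (hne n)).2 s this) (not_le.2 hlt)
  · intro v hv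
    by_contra hlt
    rw [not_le] at hlt
    obtain ⟨n, hn, hlt⟩ := hlt
    obtain ⟨s, hs⟩ := hne (n + 1)
    obtain ⟨hsS, hsw⟩ := (hagree (n + 1) s).1 hs
    refine absurd (hv hsS) (not_le.2 ?_)
    refine ⟨n, fun j hj => ?_, ?_⟩
    · exact (hsw j (by omega)).trans (hn j hj)
    · have h := hsw n (by omega)
      exact lt_of_eq_of_lt h hlt

/-- The `α`-infimax sequence: the infimum of the set of maximal sequences whose asymptotic
proportions of letters are given by `α`. -/
noncomputable def infimax {k : ℕ} [NeZero k] (α : Fin k → ℝ) : Seq k :=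
  Classical.choose (exists_isGLB (maximalSequences α))

theorem isGLB_infimax {k : ℕ} [NeZero k] (α : Fin k → ℝ) :
    IsGLB (maximalSequences α) (infimax α) :=
  Classical.choose_spec (exists_isGLB (maximalSequences α))

/-- The index of the first coordinate `α₁` of a vector `(α₁, …, αₖ)`. -/
def fst (k : ℕ) [NeZero k] : Fin k := ⟨0, Nat.pos_of_ne_zero (NeZero.ne k)⟩

/-- The index of the last coordinate `αₖ` of a vector `(α₁, …, αₖ)`. -/
def lst (k : ℕ) [NeZero k] : Fin k := ⟨k - 1, Nat.sub_one_lt (NeZero.ne k)⟩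

/-- The set `Δ` of vectors `(α₁, …, αₖ)` with non-negative entries summing to `1` and `αₖ > 0`. -/
def Delta (k : ℕ) [NeZero k] : Set (Fin k → ℝ) :=
  {α | (∀ i, 0 ≤ α i) ∧ 0 < α (lst k) ∧ ∑ i, α i = 1}

/-- `J(α) = ⌊α₁ / αₖ⌋`. -/
noncomputable def J {k : ℕ} [NeZero k] (α : Fin k → ℝ) : ℕ := ⌊α (fst k) / α (lst k)⌋₊

/-- The map `Kₙ(α) = (α₂, …, αₖ₋₁, α₁ - n αₖ, (n + 1) αₖ - α₁) / (1 - α₁)`. -/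
noncomputable def Kn {k : ℕ} [NeZero k] (n : ℕ) (α : Fin k → ℝ) : Fin k → ℝ := fun i =>
  (if h : i.val + 2 < k then α ⟨i.val + 1, by omega⟩
    else if i.val + 2 = k then α (fst k) - n * α (lst k)
    else (n + 1) * α (lst k) - α (fst k)) / (1 - α (fst k))

/-- The multi-dimensional continued fraction map `K(α) = K_{J(α)}(α)`. -/
noncomputable def K {k : ℕ} [NeZero k] (α : Fin k → ℝ) : Fin k → ℝ := Kn (J α) α

/-- `K` maps `Δ` into itself. -/
theorem mapsTo_K {k : ℕ} [NeZero k] (hk : 2 ≤ k) : Set.MapsTo K (Delta k) (Delta k) := by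
  obtain ⟨m, rfl⟩ : ∃ m, k = m + 2 := ⟨k - 2, by omega⟩
  rintro α ⟨h0, hl, hs⟩
  have e0 : fst (m + 2) = 0 := rfl
  have el : lst (m + 2) = Fin.last (m + 1) := rfl
  have hsum : α 0 + ((∑ i : Fin m, α i.succ.castSucc) + α (Fin.last (m + 1))) = 1 := by
    rw [Fin.sum_univ_castSucc, Fin.sum_univ_succ] at hs
    simpa [add_assoc] using hs
  have hm : 0 ≤ ∑ i : Fin m, α i.succ.castSucc := Finset.sum_nonneg fun i _ => h0 _
  rw [el] at hl
  have hD : 0 < 1 - α 0 := by linarith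
  have hJ1 : (J α : ℝ) * α (Fin.last (m + 1)) ≤ α 0 := by
    have := Nat.floor_le (div_nonneg (h0 0) hl.le)
    rwa [le_div_iff₀ hl] at this
  have hJ2 : α 0 < ((J α : ℝ) + 1) * α (Fin.last (m + 1)) := by
    have := Nat.lt_floor_add_one (α 0 / α (Fin.last (m + 1)))
    rwa [div_lt_iff₀ hl] at this
  have hK1 : ∀ i : Fin m, K α i.castSucc.castSucc = α i.succ.castSucc / (1 - α 0) := by
    intro i
    simp only [K, Kn, e0]
    rw [dif_pos (by simp)]
    rfl
  have hK2 : K α (Fin.last m).castSucc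
      = (α 0 - J α * α (Fin.last (m + 1))) / (1 - α 0) := by
    simp [K, Kn, e0, el]
  have hK3 : K α (Fin.last (m + 1))
      = ((J α + 1) * α (Fin.last (m + 1)) - α 0) / (1 - α 0) := by
    simp [K, Kn, e0, el]
  refine ⟨fun i => ?_, ?_, ?_⟩
  · refine Fin.lastCases ?_ (fun i => Fin.lastCases ?_ (fun i => ?_) i) i
    · rw [hK3]; exact div_nonneg (by linarith) hD.le
    · rw [hK2]; exact div_nonneg (by linarith) hD.le
    · rw [hK1]; exact div_nonneg (h0 _) hD.le
  · rw [el, hK3]; exact div_pos (by linarith) hD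
  · rw [Fin.sum_univ_castSucc, Fin.sum_univ_castSucc, hK2, hK3, Finset.sum_congr rfl
      (fun i _ => hK1 i), ← Finset.sum_div, ← add_div, ← add_div, div_eq_one_iff_eq hD.ne']
    linarith

/-- The itinerary map `Φ(α)ᵣ = J(Kʳ(α))`. -/
noncomputable def Phi {k : ℕ} [NeZero k] (α : Fin k → ℝ) : ℕ → ℕ := fun r => J (K^[r] α)

/-- The fibre `Φ⁻¹(Φ(α))` of the itinerary map `Φ : Δ → ℕ^ℕ` through `α`. -/
def fibre {k : ℕ} [NeZero k] (α : Fin k → ℝ) : Set (Fin k → ℝ) :=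
  {β | β ∈ Delta k ∧ Phi β = Phi α}

/-- `S` is a (closed) `d`-dimensional simplex: the convex hull of `d + 1` affinely independent
points. -/
def IsSimplexOfDim {k : ℕ} (d : ℕ) (S : Set (Fin k → ℝ)) : Prop :=
  ∃ s : Affine.Simplex ℝ (Fin k → ℝ) d, S = convexHull ℝ (Set.range s.points)

end Infimax

/-! Write `k = m + 2` and call the letters `0, …, m + 1`. The substitution `lam n` raises every
letter below `m` by one and sends `m` to `(m + 1) 0^(n+1)` and `m + 1` to `(m + 1) 0^n`. It
preserves the lexicographic order and maximality. On letter counts it acts by the unimodular matrix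
`abel n`, whose inverse is `Kn n` up to scaling, so `lam (J α)` carries sequences with proportions
`K α` to sequences with proportions `α`. For `n = Phi α` the compositions `Lam n r` converge to a
single sequence `limSeq n`, whatever they are applied to.

This limit is the infimax sequence (`isGLB_limSeq`). Images under `Lam n r` of members of
`maximalSequences (K^[r] α)` lie in `maximalSequences α` and converge to `limSeq n`, so no lower
bound exceeds it. Conversely, a sequence with proportions `α` either has a tail that is too large at
once, or can be desubstituted by a parenthesis-like matching of smallest letters with largest ones.
Iterating gives `exists_Lam_le_tail`, hence the lower bound. As `limSeq n` is maximal, the minimum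
exists exactly when `limSeq n` has proportions `α`.

The fibre is the base `polytope m n` of a decreasing intersection of simplicial cones, the images of
the orthant under `AbelEquiv n r` (`fibre_eq`). If it is a point, compactness puts all normalized
generators of a late cone near `α`; `limSeq n` is a concatenation of the corresponding words, so it
has proportions `α`. Conversely, the images of the largest letter are prefixes of `limSeq n`; if
their proportions converge, a recursion forces those of every letter to the same limit, and the
intersection collapses (`vert_converge`).

For (a), simplicial cones have the Riesz decomposition property, and compactness passes it to the
intersection (`cone_riesz`). It makes the extreme points of the base linearly independent, so the
base is a simplex by Krein–Milman. The matrices have determinant `±1` while their columns grow, so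
`m + 2` points of the base span zero volume with the origin; hence there are at most `m + 1` extreme
points. -/

namespace Infimax

/-! ### Finite words, prefixes and tails of infinite sequences. -/

section Words

variable {α : Type*}

/-- Prepend a letter to an infinite sequence. -/
def scons (a : α) (w : ℕ → α) : ℕ → α
  | 0 => a
  | t + 1 => w t

/-- Prepend a finite word to an infinite sequence. -/
def app (l : List α) (w : ℕ → α) : ℕ → α := l.foldr scons w

/-- The tail of an infinite sequence from position `N`. -/
def tail (N : ℕ) (w : ℕ → α) : ℕ → α := fun t => w (N + t)

/-- The word formed by the first `N` letters of an infinite sequence. -/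
def pre (w : ℕ → α) (N : ℕ) : List α := (List.range N).map w

@[simp] theorem app_nil (w : ℕ → α) : app [] w = w := rfl
@[simp] theorem app_cons (a : α) (l : List α) (w : ℕ → α) : app (a :: l) w = scons a (app l w) :=
  rfl
@[simp] theorem scons_zero (a : α) (w : ℕ → α) : scons a w 0 = a := rfl
@[simp] theorem scons_succ (a : α) (w : ℕ → α) (t : ℕ) : scons a w (t + 1) = w t := rfl
@[simp] theorem tail_zero (w : ℕ → α) : tail 0 w = w := by funext t; simp [tail]
@[simp] theorem tail_apply (N : ℕ) (w : ℕ → α) (t : ℕ) : tail N w t = w (N + t) := rfl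

theorem tail_tail (M N : ℕ) (w : ℕ → α) : tail M (tail N w) = tail (N + M) w := by
  funext t; simp [add_assoc]

theorem app_append (l l' : List α) (w : ℕ → α) : app (l ++ l') w = app l (app l' w) := by
  simp [app]

@[simp] theorem tail_scons (a : α) (w : ℕ → α) (N : ℕ) : tail (N + 1) (scons a w) = tail N w := by
  funext t
  rw [tail_apply, show N + 1 + t = (N + t) + 1 by omega]; rfl

theorem scons_tail (w : ℕ → α) : scons (w 0) (tail 1 w) = w := by
  funext t; cases t <;> simp [add_comm]

@[simp] theorem pre_zero (w : ℕ → α) : pre w 0 = [] := rfl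

theorem pre_succ (w : ℕ → α) (N : ℕ) : pre w (N + 1) = pre w N ++ [w N] := by
  simp [pre, List.range_succ]

theorem pre_succ' (w : ℕ → α) (N : ℕ) : pre w (N + 1) = w 0 :: pre (tail 1 w) N := by
  simp [pre, List.range_succ_eq_map, add_comm]

@[simp] theorem length_pre (w : ℕ → α) (N : ℕ) : (pre w N).length = N := by simp [pre]

theorem app_pre_tail (w : ℕ → α) (N : ℕ) : app (pre w N) (tail N w) = w := by
  induction N generalizing w with
  | zero => simp
  | succ N ih =>
    have := ih (tail 1 w)
    rw [tail_tail, add_comm 1 N] at this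
    rw [pre_succ', app_cons, this, scons_tail]

theorem tail_app (l : List α) (w : ℕ → α) (N : ℕ) : tail (l.length + N) (app l w) = tail N w := by
  induction l with
  | nil => simp
  | cons a l ih =>
    rw [List.length_cons, app_cons, show l.length + 1 + N = (l.length + N) + 1 by omega,
      tail_scons, ih]

theorem app_apply_add (l : List α) (w : ℕ → α) (t : ℕ) : app l w (l.length + t) = w t := by
  have := congrFun (tail_app l w 0) t
  simpa using this

theorem pre_add (w : ℕ → α) (M N : ℕ) : pre w (M + N) = pre w M ++ pre (tail M w) N := by
  induction N with
  | zero => simp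
  | succ N ih => rw [← add_assoc, pre_succ, ih, pre_succ, List.append_assoc]; rfl

theorem pre_app_length (l : List α) (w : ℕ → α) : pre (app l w) l.length = l := by
  induction l with
  | nil => rfl
  | cons a l ih => rw [List.length_cons, pre_succ', app_cons]; simp [ih]

theorem pre_app (l : List α) (w : ℕ → α) (N : ℕ) :
    pre (app l w) (l.length + N) = l ++ pre w N := by
  rw [pre_add, pre_app_length]
  have := tail_app l w 0
  rw [add_zero] at this
  rw [this, tail_zero]

theorem pre_eq_iff {x y : ℕ → α} {N : ℕ} : pre x N = pre y N ↔ ∀ i < N, x i = y i := by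
  simp [pre]

/-- A strictly increasing sequence starting at `0` partitions `ℕ` into intervals. -/
theorem exists_between {ℓ : ℕ → ℕ} (h : StrictMono ℓ) (h0 : ℓ 0 = 0) (t : ℕ) :
    ∃ N, ℓ N ≤ t ∧ t < ℓ (N + 1) := by
  have hex : ∃ N, t < ℓ (N + 1) := ⟨t, lt_of_lt_of_le (Nat.lt_succ_self t) h.le_apply⟩
  classical
  refine ⟨Nat.find hex, ?_, Nat.find_spec hex⟩
  rcases hN : Nat.find hex with _ | N
  · omega
  · have := Nat.find_min hex (m := N) (by omega)
    omega

end Words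

/-! ### The lexicographic order and maximality in terms of tails. -/

section Order

variable {k : ℕ}

theorem toLex_lt_iff {x y : ℕ → Fin k} :
    toLex x < toLex y ↔ ∃ t, (∀ i < t, x i = y i) ∧ x t < y t := Iff.rfl

theorem toLex_lt_iff_app {x y : ℕ → Fin k} :
    toLex x < toLex y ↔ ∃ l x' y', x = app l x' ∧ y = app l y' ∧ x' 0 < y' 0 := by
  rw [toLex_lt_iff]
  constructor
  · rintro ⟨t, h, hlt⟩
    refine ⟨pre x t, tail t x, tail t y, (app_pre_tail x t).symm, ?_, by simpa using hlt⟩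
    rw [pre_eq_iff.2 h, app_pre_tail]
  · rintro ⟨l, x', y', rfl, rfl, hlt⟩
    refine ⟨l.length, pre_eq_iff.1 ?_, ?_⟩
    · rw [pre_app_length, pre_app_length]
    · simpa using (app_apply_add l x' 0).trans_lt (hlt.trans_eq (app_apply_add l y' 0).symm)

theorem app_lt_app {x y : ℕ → Fin k} (l : List (Fin k)) (h : toLex x < toLex y) :
    toLex (app l x) < toLex (app l y) := by
  obtain ⟨l', x', y', rfl, rfl, hlt⟩ := toLex_lt_iff_app.1 h
  exact toLex_lt_iff_app.2 ⟨l ++ l', x', y', (app_append ..).symm, (app_append ..).symm, hlt⟩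

theorem lt_of_zero_lt {x y : ℕ → Fin k} (h : x 0 < y 0) : toLex x < toLex y :=
  toLex_lt_iff.2 ⟨0, by simp, h⟩

theorem zero_le_of_le {x y : ℕ → Fin k} (h : toLex x ≤ toLex y) : x 0 ≤ y 0 := by
  by_contra hlt
  exact absurd (lt_of_zero_lt (not_le.1 hlt)) (not_lt.2 h)

theorem iterate_shift (w : Seq k) (r : ℕ) : shift^[r] w = toLex (tail r (ofLex w)) := by
  induction r generalizing w with
  | zero => simp
  | succ r ih =>
    rw [Function.iterate_succ_apply, ih]
    have : ofLex (shift w) = tail 1 (ofLex w) := by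
      funext t; simp [shift, add_comm]
    rw [this, tail_tail, add_comm]

theorem isMaximalSeq_iff {x : ℕ → Fin k} :
    IsMaximalSeq (toLex x) ↔ ∀ r, toLex (tail r x) ≤ toLex x := by
  simp only [IsMaximalSeq, iterate_shift, ofLex_toLex]

end Order

/-! ### The substitutions, their monotonicity, and the limit sequence. -/

section Substitution

variable {m : ℕ}

/-- The first letter of the image of a letter under the substitutions. -/
def hd (i : Fin (m + 2)) : Fin (m + 2) := ⟨min (i.val + 1) (m + 1), by omega⟩

/-- The number of trailing `0`s in the image of a letter under the `n`-th substitution. -/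
def zs (n : ℕ) (i : Fin (m + 2)) : ℕ :=
  if i.val = m + 1 then n else if i.val = m then n + 1 else 0

/-- The image of a letter under the `n`-th substitution. -/
def blk (n : ℕ) (i : Fin (m + 2)) : List (Fin (m + 2)) := hd i :: List.replicate (zs n i) 0

/-- The `n`-th substitution on finite words. -/
def lamW (n : ℕ) (l : List (Fin (m + 2))) : List (Fin (m + 2)) := l.flatMap (blk n)

/-- Letter `t` of the image of `w` under the `n`-th substitution, with `c` letters `0` prepended. -/
def lamAux (n : ℕ) : ℕ → (ℕ → Fin (m + 2)) → ℕ → Fin (m + 2)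
  | 0, w, 0 => hd (w 0)
  | 0, _, _ + 1 => 0
  | t + 1, w, 0 => lamAux n t (tail 1 w) (zs n (w 0))
  | t + 1, w, c + 1 => lamAux n t w c

/-- The `n`-th substitution on infinite sequences. -/
def lam (n : ℕ) (w : ℕ → Fin (m + 2)) : ℕ → Fin (m + 2) := fun t => lamAux n t w 0

theorem hd_pos (i : Fin (m + 2)) : 0 < hd i := by
  simp [hd, Fin.lt_def]

@[simp] theorem hd_last : hd (Fin.last (m + 1)) = Fin.last (m + 1) := by
  simp [hd, Fin.ext_iff]

theorem lamAux_eq (n : ℕ) (w : ℕ → Fin (m + 2)) (c : ℕ) :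
    (fun t => lamAux n t w c) = app (List.replicate c 0) (lam n w) := by
  induction c with
  | zero => rfl
  | succ c ih =>
    rw [List.replicate_succ, app_cons, ← ih]
    funext t
    cases t <;> rfl

theorem lam_eq (n : ℕ) (w : ℕ → Fin (m + 2)) :
    lam n w = app (blk n (w 0)) (lam n (tail 1 w)) := by
  rw [blk, app_cons, ← lamAux_eq]
  funext t
  cases t <;> rfl

@[simp] theorem lam_zero (n : ℕ) (w : ℕ → Fin (m + 2)) : lam n w 0 = hd (w 0) := rfl

@[simp] theorem lamW_nil (n : ℕ) : lamW n ([] : List (Fin (m + 2))) = [] := rfl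

theorem lamW_append (n : ℕ) (l l' : List (Fin (m + 2))) :
    lamW n (l ++ l') = lamW n l ++ lamW n l' := by simp [lamW]

theorem lam_app (n : ℕ) (l : List (Fin (m + 2))) (w : ℕ → Fin (m + 2)) :
    lam n (app l w) = app (lamW n l) (lam n w) := by
  induction l with
  | nil => rfl
  | cons a l ih =>
    rw [lam_eq, app_cons, scons_zero, tail_scons, tail_zero, ih, ← app_append]
    rfl

/-- The first letter of the image separates all pairs of letters except `m` and `m + 1`. For these,
the image of `m` is the image of `m + 1` followed by one more `0`, whereas the image of `m + 1` is
followed by the start of another block, which is positive. -/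
theorem lam_strictMono (n : ℕ) {x y : ℕ → Fin (m + 2)} (h : toLex x < toLex y) :
    toLex (lam n x) < toLex (lam n y) := by
  obtain ⟨l, x, y, rfl, rfl, hlt⟩ := toLex_lt_iff_app.1 h
  rw [lam_app, lam_app]
  apply app_lt_app
  by_cases hh : hd (x 0) < hd (y 0)
  · exact lt_of_zero_lt hh
  have hy := (y 0).isLt
  simp only [hd, Fin.lt_def] at hh hlt
  have hym : (y 0).val = m + 1 := by omega
  have hxm : (x 0).val = m := by omega
  rw [lam_eq n x, lam_eq n y]
  have e : blk n (x 0) = blk n (y 0) ++ [0] := by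
    have : hd (x 0) = hd (y 0) := by simp [hd, hym, hxm]
    simp [blk, zs, this, hym, hxm, List.replicate_succ']
  rw [e, app_append]
  apply app_lt_app
  apply lt_of_zero_lt
  simpa using hd_pos _

theorem lam_mono (n : ℕ) {x y : ℕ → Fin (m + 2)} (h : toLex x ≤ toLex y) :
    toLex (lam n x) ≤ toLex (lam n y) := by
  rcases h.eq_or_lt with h | h
  · rw [toLex_inj] at h; rw [h]
  · exact (lam_strictMono n h).le

theorem length_blk (n : ℕ) (i : Fin (m + 2)) : (blk n i).length = zs n i + 1 := by simp [blk]

theorem strictMono_length_lamW (n : ℕ) (w : ℕ → Fin (m + 2)) :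
    StrictMono fun N => (lamW n (pre w N)).length := by
  refine strictMono_nat_of_lt_succ fun N => ?_
  simp [pre_succ, lamW, length_blk]

/-- Each position of a substituted sequence lies in the image of one letter. -/
theorem exists_block (n : ℕ) (w : ℕ → Fin (m + 2)) (t : ℕ) :
    ∃ N s, t = (lamW n (pre w N)).length + s ∧ s < (blk n (w N)).length := by
  obtain ⟨N, h1, h2⟩ := exists_between (strictMono_length_lamW n w) rfl t
  refine ⟨N, t - (lamW n (pre w N)).length, by omega, ?_⟩
  simp only [pre_succ, lamW_append, List.length_append] at h1 h2
  have : (lamW n [w N]).length = (blk n (w N)).length := by simp [lamW]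
  omega

theorem lam_eq_app_pre (n : ℕ) (w : ℕ → Fin (m + 2)) (N : ℕ) :
    lam n w = app (lamW n (pre w N)) (lam n (tail N w)) := by
  rw [← lam_app, app_pre_tail]

theorem tail_lam (n : ℕ) (w : ℕ → Fin (m + 2)) (N s : ℕ) :
    tail ((lamW n (pre w N)).length + s) (lam n w) = tail s (lam n (tail N w)) := by
  conv_lhs => rw [lam_eq_app_pre n w N, tail_app]

theorem lam_apply_succ_of_lt (n : ℕ) (w : ℕ → Fin (m + 2)) {s : ℕ} (hs : s < zs n (w 0)) :
    lam n w (s + 1) = 0 := by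
  rw [lam_eq, blk, app_cons, scons_succ]
  generalize zs n (w 0) = c at hs
  generalize lam n (tail 1 w) = x
  induction c generalizing s with
  | zero => omega
  | succ c ih =>
    rw [List.replicate_succ, app_cons]
    cases s with
    | zero => rfl
    | succ s => exact ih (by omega)

/-- A tail starting at a block boundary is the image of a tail, so monotonicity applies; a tail
starting inside a block begins with `0`, while the whole sequence begins with a positive letter. -/
theorem lam_isMaximal (n : ℕ) {w : ℕ → Fin (m + 2)} (h : IsMaximalSeq (toLex w)) :
    IsMaximalSeq (toLex (lam n w)) := by
  rw [isMaximalSeq_iff] at h ⊢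
  intro t
  obtain ⟨N, s, rfl, hs⟩ := exists_block n w t
  rw [tail_lam]
  rcases s with _ | s
  · rw [tail_zero]; exact lam_mono n (h N)
  · refine (lt_of_zero_lt ?_).le
    rw [tail_apply, add_zero, lam_apply_succ_of_lt, lam_zero]
    · exact hd_pos _
    · rw [length_blk] at hs; simpa using hs

/-- The first letters of two sequences, up to a position where both letters are at least `j`,
agree. -/
def AgreeUpTo (N j : ℕ) (x y : ℕ → Fin (m + 2)) : Prop :=
  ∃ l x' y', x = app l x' ∧ y = app l y' ∧ N ≤ l.length ∧ j ≤ (x' 0).val ∧ j ≤ (y' 0).val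

theorem AgreeUpTo.lam {N j : ℕ} {x y : ℕ → Fin (m + 2)} (h : AgreeUpTo N j x y) (hj : j ≤ m)
    (n : ℕ) : AgreeUpTo N (j + 1) (lam n x) (lam n y) := by
  obtain ⟨l, x, y, rfl, rfl, hl, hx, hy⟩ := h
  refine ⟨lamW n l, _, _, lam_app .., lam_app .., ?_, ?_, ?_⟩
  · refine hl.trans ?_
    rw [lamW, List.length_flatMap]
    have : l.length = (l.map fun _ => 1).sum := by simp
    rw [this]
    exact List.sum_le_sum fun i _ => by simp [length_blk]
  · simp [hd]; omega
  · simp [hd]; omega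

theorem AgreeUpTo.eq {N j : ℕ} {x y : ℕ → Fin (m + 2)} (h : AgreeUpTo N j x y) :
    pre x N = pre y N := by
  obtain ⟨l, x, y, rfl, rfl, hl, hx, hy⟩ := h
  rw [pre_eq_iff]
  have := pre_eq_iff.1 ((pre_app_length l x).trans (pre_app_length l y).symm)
  exact fun i hi => this i (by omega)

theorem agreeUpTo_zero {N : ℕ} {x y : ℕ → Fin (m + 2)} (h : pre x N = pre y N) :
    AgreeUpTo N 0 x y :=
  ⟨pre x N, tail N x, tail N y, (app_pre_tail x N).symm, by rw [h, app_pre_tail], by simp,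
    by simp, by simp⟩

/-- At level `m + 1` both distinguished letters are forced to be the largest one, so the agreement
extends by one position and the level restarts at `0`. -/
theorem AgreeUpTo.succ {N : ℕ} {x y : ℕ → Fin (m + 2)} (h : AgreeUpTo N (m + 1) x y) :
    AgreeUpTo (N + 1) 0 x y := by
  obtain ⟨l, x, y, rfl, rfl, hl, hx, hy⟩ := h
  refine ⟨l ++ [x 0], tail 1 x, tail 1 y, ?_, ?_, by simpa, by simp, by simp⟩
  · rw [app_append, app_cons, app_nil, scons_tail]
  · have : x 0 = y 0 := by ext; omega
    rw [app_append, app_cons, app_nil, this, scons_tail]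

theorem pre_lam_eq {N : ℕ} {x y : ℕ → Fin (m + 2)} (h : pre x N = pre y N) (n : ℕ) :
    pre (lam n x) N = pre (lam n y) N := ((agreeUpTo_zero h).lam (Nat.zero_le _) n).eq

/-- The composition of the substitutions `n 0, …, n (r - 1)` on infinite sequences. -/
def Lam (n : ℕ → ℕ) : ℕ → (ℕ → Fin (m + 2)) → (ℕ → Fin (m + 2))
  | 0, x => x
  | r + 1, x => Lam n r (lam (n r) x)

/-- The composition of the substitutions `n 0, …, n (r - 1)` on finite words. -/
def LamW (n : ℕ → ℕ) : ℕ → List (Fin (m + 2)) → List (Fin (m + 2))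
  | 0, l => l
  | r + 1, l => LamW n r (lamW (n r) l)

theorem Lam_add (n : ℕ → ℕ) (r s : ℕ) (x : ℕ → Fin (m + 2)) :
    Lam n (r + s) x = Lam n r (Lam (tail r n) s x) := by
  induction s generalizing x with
  | zero => rfl
  | succ s ih => exact ih _

theorem Lam_succ' (n : ℕ → ℕ) (r : ℕ) (x : ℕ → Fin (m + 2)) :
    Lam n (r + 1) x = lam (n 0) (Lam (tail 1 n) r x) := by
  rw [add_comm r 1, Lam_add]; rfl

theorem Lam_app (n : ℕ → ℕ) (r : ℕ) (l : List (Fin (m + 2))) (w : ℕ → Fin (m + 2)) :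
    Lam n r (app l w) = app (LamW n r l) (Lam n r w) := by
  induction r generalizing l w with
  | zero => rfl
  | succ r ih => rw [Lam, lam_app, ih]; rfl

theorem LamW_append (n : ℕ → ℕ) (r : ℕ) (l l' : List (Fin (m + 2))) :
    LamW n r (l ++ l') = LamW n r l ++ LamW n r l' := by
  induction r generalizing l l' with
  | zero => rfl
  | succ r ih => rw [LamW, lamW_append, ih]; rfl

theorem LamW_nil (n : ℕ → ℕ) (r : ℕ) : LamW n r ([] : List (Fin (m + 2))) = [] := by
  induction r with
  | zero => rfl
  | succ r ih => exact ih

theorem pre_Lam_eq {N : ℕ} {x y : ℕ → Fin (m + 2)} (h : pre x N = pre y N) (n : ℕ → ℕ) (r : ℕ) :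
    pre (Lam n r x) N = pre (Lam n r y) N := by
  induction r generalizing x y with
  | zero => exact h
  | succ r ih => exact ih (pre_lam_eq h _)

/-- The quantity `N * (m + 1) + j` gains one with each substitution: either the level `j` rises, or
it has reached its top `m + 1` and is exchanged for one more agreeing letter. -/
theorem exists_agreeUpTo_Lam (n : ℕ → ℕ) (r : ℕ) (x y : ℕ → Fin (m + 2)) :
    ∃ N j, AgreeUpTo N j (Lam n r x) (Lam n r y) ∧ j ≤ m + 1 ∧ r ≤ N * (m + 1) + j := by
  induction r generalizing n with
  | zero => exact ⟨0, 0, agreeUpTo_zero rfl, by omega, by omega⟩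
  | succ r ih =>
    obtain ⟨N, j, h, hj, hr⟩ := ih (tail 1 n)
    rw [Lam_succ', Lam_succ']
    rcases hj.eq_or_lt with rfl | hj
    · exact ⟨N + 1, 1, h.succ.lam (Nat.zero_le _) _, by omega, by linarith [add_one_mul N (m + 1)]⟩
    · exact ⟨N, j + 1, h.lam (by omega) _, by omega, by omega⟩

theorem pre_Lam_eq_pre_Lam (n : ℕ → ℕ) {N r : ℕ} (h : (N + 1) * (m + 1) ≤ r)
    (x y : ℕ → Fin (m + 2)) : pre (Lam n r x) N = pre (Lam n r y) N := by
  obtain ⟨N', j, ha, hj, hr⟩ := exists_agreeUpTo_Lam n r x y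
  have hN : N ≤ N' := by
    by_contra hlt
    have : (N' + 1) * (m + 1) ≤ N * (m + 1) := Nat.mul_le_mul_right _ (by omega)
    linarith [add_one_mul N' (m + 1), add_one_mul N (m + 1)]
  exact pre_eq_iff.2 fun i hi => pre_eq_iff.1 ha.eq i (by omega)

/-- The limit of the substitutions `n 0, …, n (r - 1)` as `r → ∞`. -/
def limSeq (n : ℕ → ℕ) : ℕ → Fin (m + 2) :=
  -- Position `t` lies in the prefix of length `t + 1`, which is stable after `(t + 2) * (m + 1)`
  -- substitutions.
  fun t => Lam n ((t + 2) * (m + 1)) (fun _ => Fin.last _) t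

theorem pre_Lam_eq_limSeq (n : ℕ → ℕ) {N r : ℕ} (h : (N + 1) * (m + 1) ≤ r)
    (x : ℕ → Fin (m + 2)) : pre (Lam n r x) N = pre (limSeq n) N := by
  refine pre_eq_iff.2 fun i hi => ?_
  have h1 : (i + 2) * (m + 1) ≤ (N + 1) * (m + 1) := Nat.mul_le_mul_right _ (by omega)
  obtain ⟨s, rfl⟩ := Nat.exists_eq_add_of_le (h1.trans h)
  rw [Lam_add]
  exact pre_eq_iff.1 (pre_Lam_eq_pre_Lam n le_rfl _ _) i (by omega)

theorem limSeq_eq_Lam (n : ℕ → ℕ) (r : ℕ) :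
    (limSeq n : ℕ → Fin (m + 2)) = Lam n r (limSeq (tail r n)) := by
  funext t
  set R := (t + 2) * (m + 1)
  have h1 := pre_Lam_eq (pre_Lam_eq_limSeq (m := m) (tail r n) (N := t + 1) (r := R) le_rfl
    fun _ => 0) n r
  rw [← Lam_add, pre_Lam_eq_limSeq n (le_trans le_rfl (Nat.le_add_left _ _))] at h1
  exact pre_eq_iff.1 h1 t (by omega)

theorem Lam_zero_of_last (n : ℕ → ℕ) (r : ℕ) {x : ℕ → Fin (m + 2)} (h : x 0 = Fin.last (m + 1)) :
    Lam n r x 0 = Fin.last (m + 1) := by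
  induction r generalizing x with
  | zero => exact h
  | succ r ih => exact ih (by simp [h])

theorem limSeq_zero (n : ℕ → ℕ) : (limSeq n : ℕ → Fin (m + 2)) 0 = Fin.last (m + 1) :=
  Lam_zero_of_last _ _ rfl

theorem Lam_isMaximal (n : ℕ → ℕ) (r : ℕ) {w : ℕ → Fin (m + 2)} (h : IsMaximalSeq (toLex w)) :
    IsMaximalSeq (toLex (Lam n r w)) := by
  induction r generalizing w with
  | zero => exact h
  | succ r ih => exact ih (lam_isMaximal _ h)

/-- A strict lexicographic inequality is decided on a finite prefix. This is what transfers
inequalities between `limSeq n` and the approximations `Lam n r x`. -/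
theorem lt_of_pre_eq {k : ℕ} {x y x' y' : ℕ → Fin k} {t : ℕ} (h : ∀ i < t, x i = y i)
    (ht : x t < y t) (hx : pre x (t + 1) = pre x' (t + 1)) (hy : pre y (t + 1) = pre y' (t + 1)) :
    toLex x' < toLex y' := by
  rw [pre_eq_iff] at hx hy
  refine toLex_lt_iff.2 ⟨t, fun i hi => ?_, ?_⟩
  · rw [← hx i (by omega), ← hy i (by omega), h i hi]
  · rw [← hx t (by omega), ← hy t (by omega)]; exact ht

theorem limSeq_isMaximal (n : ℕ → ℕ) : IsMaximalSeq (toLex (limSeq (m := m) n)) := by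
  rw [isMaximalSeq_iff]
  intro r
  by_contra hlt
  obtain ⟨t, h, ht⟩ := toLex_lt_iff.1 (not_le.1 hlt)
  have hmax := Lam_isMaximal (m := m) n ((r + t + 1 + 1) * (m + 1))
    (w := fun _ => Fin.last (m + 1)) (isMaximalSeq_iff.2 fun _ => le_rfl)
  have hp := pre_eq_iff.1 (pre_Lam_eq_limSeq (m := m) n (N := r + t + 1) le_rfl
    fun _ => Fin.last (m + 1))
  refine absurd (isMaximalSeq_iff.1 hmax r) (not_le.2 (lt_of_pre_eq h ht ?_ ?_))
  · exact pre_eq_iff.2 fun i hi => (hp i (by omega)).symm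
  · exact pre_eq_iff.2 fun i hi => (hp (r + i) (by omega)).symm

theorem limSeq_le_of_Lam_le (n : ℕ → ℕ) {w x : ℕ → Fin (m + 2)}
    (h : ∀ r, toLex (Lam n r x) ≤ toLex w) : toLex (limSeq n) ≤ toLex w := by
  by_contra hlt
  obtain ⟨t, h1, ht⟩ := toLex_lt_iff.1 (not_le.1 hlt)
  exact absurd (h _) (not_le.2 (lt_of_pre_eq h1 ht rfl
    (pre_Lam_eq_limSeq n (N := t + 1) le_rfl x).symm))

theorem le_limSeq_of_le_Lam (n : ℕ → ℕ) {w : ℕ → Fin (m + 2)}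
    (h : ∀ r, ∃ x, toLex w ≤ toLex (Lam n r x)) : toLex w ≤ toLex (limSeq n) := by
  by_contra hlt
  obtain ⟨t, h1, ht⟩ := toLex_lt_iff.1 (not_le.1 hlt)
  obtain ⟨x, hx⟩ := h ((t + 1 + 1) * (m + 1))
  exact absurd hx (not_le.2 (lt_of_pre_eq h1 ht
    (pre_Lam_eq_limSeq n (N := t + 1) le_rfl x).symm rfl))

end Substitution

/-! ### The substitution matrices and their inverses. -/

section Abelianization

variable {m : ℕ} {R : Type*} [CommRing R]

/-- The second largest letter. -/
abbrev penult (m : ℕ) : Fin (m + 2) := (Fin.last m).castSucc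

/-- The abelianization of the `n`-th substitution: it sends the vector counting the letters of a
word to the vector counting the letters of its image. -/
def abel (n : ℕ) (c : Fin (m + 2) → R) : Fin (m + 2) → R := fun i =>
  if i.val = 0 then (n + 1) * c (penult m) + n * c (Fin.last (m + 1))
  else if h : i.val ≤ m then c ⟨i.val - 1, by omega⟩
  else c (penult m) + c (Fin.last (m + 1))

/-- The inverse of `abel n`, an unnormalized version of `Kn n`. -/
def abelInv (n : ℕ) (a : Fin (m + 2) → R) : Fin (m + 2) → R := fun i =>
  if h : i.val < m then a ⟨i.val + 1, by omega⟩
  else if i.val = m then a 0 - n * a (Fin.last (m + 1))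
  else (n + 1) * a (Fin.last (m + 1)) - a 0

theorem abel_zero (n : ℕ) (c : Fin (m + 2) → R) :
    abel n c 0 = (n + 1) * c (penult m) + n * c (Fin.last (m + 1)) := by simp [abel]

theorem abel_last (n : ℕ) (c : Fin (m + 2) → R) :
    abel n c (Fin.last (m + 1)) = c (penult m) + c (Fin.last (m + 1)) := by simp [abel]

theorem abel_mid (n : ℕ) (c : Fin (m + 2) → R) (j : ℕ) (h : j < m) :
    abel n c ⟨j + 1, by omega⟩ = c ⟨j, by omega⟩ := by
  simp [abel, Nat.succ_le_of_lt h]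

theorem abelInv_mid (n : ℕ) (a : Fin (m + 2) → R) (j : ℕ) (h : j < m) :
    abelInv n a ⟨j, by omega⟩ = a ⟨j + 1, by omega⟩ := by
  simp [abelInv, h]

theorem abelInv_penult (n : ℕ) (a : Fin (m + 2) → R) :
    abelInv n a (penult m) = a 0 - n * a (Fin.last (m + 1)) := by simp [abelInv]

theorem abelInv_last (n : ℕ) (a : Fin (m + 2) → R) :
    abelInv n a (Fin.last (m + 1)) = (n + 1) * a (Fin.last (m + 1)) - a 0 := by simp [abelInv]

theorem index_cases (i : Fin (m + 2)) :
    i = 0 ∨ i = Fin.last (m + 1) ∨ ∃ j, ∃ h : j < m, i = ⟨j + 1, by omega⟩ := by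
  obtain ⟨i, hi⟩ := i
  rcases i with _ | j
  · exact Or.inl rfl
  · rcases Nat.lt_or_ge j m with h | h
    · exact Or.inr (Or.inr ⟨j, h, rfl⟩)
    · exact Or.inr (Or.inl (by ext; simp; omega))

theorem index_cases' (i : Fin (m + 2)) :
    i = penult m ∨ i = Fin.last (m + 1) ∨ ∃ j, ∃ h : j < m, i = ⟨j, by omega⟩ := by
  obtain ⟨i, hi⟩ := i
  rcases Nat.lt_trichotomy i m with h | h | h
  · exact Or.inr (Or.inr ⟨i, h, rfl⟩)
  · exact Or.inl (by ext; simpa)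
  · exact Or.inr (Or.inl (by ext; simp; omega))

variable (R) in
/-- `abel n` as a linear equivalence. -/
def abelEquiv (m n : ℕ) : (Fin (m + 2) → R) ≃ₗ[R] (Fin (m + 2) → R) where
  toFun := abel n
  invFun := abelInv n
  map_add' c d := by
    funext i
    simp only [abel, Pi.add_apply]
    split_ifs <;> ring
  map_smul' a c := by
    funext i
    simp only [abel, Pi.smul_apply, smul_eq_mul, RingHom.id_apply]
    split_ifs <;> ring
  left_inv c := by
    funext i
    rcases index_cases' i with rfl | rfl | ⟨j, h, rfl⟩
    · rw [abelInv_penult, abel_zero, abel_last]; ring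
    · rw [abelInv_last, abel_zero, abel_last]; ring
    · rw [abelInv_mid _ _ _ h, abel_mid _ _ _ h]
  right_inv a := by
    funext i
    rcases index_cases i with rfl | rfl | ⟨j, h, rfl⟩
    · rw [abel_zero, abelInv_penult, abelInv_last]; ring
    · rw [abel_last, abelInv_penult, abelInv_last]; ring
    · rw [abel_mid _ _ _ h, abelInv_mid _ _ _ h]

@[simp] theorem abelEquiv_apply (n : ℕ) (c : Fin (m + 2) → R) : abelEquiv R m n c = abel n c := rfl
@[simp] theorem abelEquiv_symm_apply (n : ℕ) (c : Fin (m + 2) → R) :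
    (abelEquiv R m n).symm c = abelInv n c := rfl

theorem sum_split (c : Fin (m + 2) → R) :
    ∑ i, c i = c 0 + (∑ i : Fin m, c ⟨i.val + 1, by omega⟩) + c (Fin.last (m + 1)) := by
  rw [Fin.sum_univ_castSucc, Fin.sum_univ_succ]; rfl

end Abelianization

/-! ### Letter counts of substituted words; unimodularity and positivity. -/

section Counting

variable {m : ℕ}

/-- The matrix and its inverse both have integer entries, so the determinant is a unit of `ℤ`. -/
theorem abelEquiv_det (m n : ℕ) :
    |LinearMap.det (abelEquiv ℝ m n : (Fin (m + 2) → ℝ) →ₗ[ℝ] (Fin (m + 2) → ℝ))| = 1 := by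
  have hZ : IsUnit (LinearMap.det (abelEquiv ℤ m n : (Fin (m + 2) → ℤ) →ₗ[ℤ] (Fin (m + 2) → ℤ))) :=
    LinearEquiv.isUnit_det' _
  have hM : LinearMap.toMatrix' (abelEquiv ℝ m n : (Fin (m + 2) → ℝ) →ₗ[ℝ] (Fin (m + 2) → ℝ)) =
      (LinearMap.toMatrix' (abelEquiv ℤ m n : (Fin (m + 2) → ℤ) →ₗ[ℤ] (Fin (m + 2) → ℤ))).map
        (Int.castRingHom ℝ) := by
    ext i j
    simp only [LinearMap.toMatrix'_apply, Matrix.map_apply, LinearEquiv.coe_coe, abelEquiv_apply,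
      abel, Pi.single_apply]
    split_ifs <;> norm_num
  rw [← LinearMap.det_toMatrix', hM]
  change |((LinearMap.toMatrix' (abelEquiv ℤ m n :
    (Fin (m + 2) → ℤ) →ₗ[ℤ] (Fin (m + 2) → ℤ))).map (Int.castRingHom ℝ)).det| = 1
  rw [← RingHom.mapMatrix_apply, ← RingHom.map_det, LinearMap.det_toMatrix']
  rcases Int.isUnit_iff.1 hZ with h | h <;> simp [h]

/-- The vector counting the letters of a word. -/
def counts (l : List (Fin (m + 2))) : Fin (m + 2) → ℝ := fun i => l.count i

@[simp] theorem counts_nil : counts ([] : List (Fin (m + 2))) = 0 := by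
  funext i; simp [counts]

theorem counts_append (l l' : List (Fin (m + 2))) : counts (l ++ l') = counts l + counts l' := by
  funext i; simp [counts]

theorem counts_nonneg (l : List (Fin (m + 2))) (i) : 0 ≤ counts l i := Nat.cast_nonneg _

theorem sum_counts (l : List (Fin (m + 2))) : ∑ i, counts l i = l.length := by
  induction l with
  | nil => simp
  | cons a l ih =>
    have : counts (a :: l) = Pi.single a 1 + counts l := by
      funext i
      simp only [counts, List.count_cons, Pi.add_apply, Pi.single_apply, beq_iff_eq]
      by_cases h : a = i
      · simp [h, add_comm]
      · simp [h, Ne.symm h]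
    simp [this, Finset.sum_add_distrib, ih, add_comm]

theorem counts_singleton (a : Fin (m + 2)) : counts [a] = Pi.single a 1 := by
  funext i
  by_cases h : i = a
  · simp [counts, h]
  · simp [counts, h, Ne.symm h]

theorem counts_blk (n : ℕ) (a : Fin (m + 2)) : counts (blk n a) = abel n (counts [a]) := by
  have h1 : ∀ i, counts (blk n a) i = (if hd a = i then 1 else 0) +
      (if i = 0 then (zs n a : ℝ) else 0) := by
    intro i
    simp only [counts, blk, List.count_cons, List.count_replicate, beq_iff_eq]
    by_cases h : i = 0
    · simp [h, add_comm]
    · simp [h, Ne.symm h]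
  funext i
  rw [h1]
  have hla : Fin.last (m + 1) ≠ penult m := by simp [Fin.ext_iff]
  rcases index_cases i with rfl | rfl | ⟨j, h, rfl⟩
  · rw [abel_zero, counts_singleton, if_neg (hd_pos a).ne']
    rcases index_cases' a with rfl | rfl | ⟨j, h, rfl⟩
    · simp [zs, hla]
    · simp [zs]
    · have h1 : (Fin.last (m + 1)) ≠ ⟨j, by omega⟩ := by simp [Fin.ext_iff]; omega
      have h2 : penult m ≠ ⟨j, by omega⟩ := by simp [Fin.ext_iff]; omega
      simp [zs, h1, h2, h.ne, (show j ≠ m + 1 by omega)]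
  · rw [abel_last, counts_singleton]
    rcases index_cases' a with rfl | rfl | ⟨j, h, rfl⟩
    · simp [hd, hla, Fin.ext_iff]
    · simp [hla.symm]
    · have h1 : (Fin.last (m + 1)) ≠ ⟨j, by omega⟩ := by simp [Fin.ext_iff]; omega
      have h2 : penult m ≠ ⟨j, by omega⟩ := by simp [Fin.ext_iff]; omega
      simp [h1, h2, hd, Fin.ext_iff]; omega
  · rw [abel_mid _ _ _ h, counts_singleton, Pi.single_apply]
    have := a.isLt
    by_cases hja : j = a.val
    · have e : (⟨j, by omega⟩ : Fin (m + 2)) = a := Fin.ext hja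
      rw [if_pos e, if_pos (by ext; simp [hd]; omega)]
      simp
    · have e : (⟨j, by omega⟩ : Fin (m + 2)) ≠ a := fun h => hja (Fin.ext_iff.1 h)
      rw [if_neg e, if_neg (by simp [hd, Fin.ext_iff]; omega)]
      simp

theorem counts_lamW (n : ℕ) (l : List (Fin (m + 2))) : counts (lamW n l) = abel n (counts l) := by
  rw [← abelEquiv_apply]
  induction l with
  | nil => rw [lamW_nil, counts_nil, map_zero]
  | cons a l ih =>
    rw [show a :: l = [a] ++ l from rfl, lamW_append, counts_append, ih, counts_append, map_add]
    congr 1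
    simpa [lamW] using counts_blk n a

/-- The abelianization of the composition of the substitutions `n 0, …, n (r - 1)`. -/
def AbelEquiv (n : ℕ → ℕ) : ℕ → (Fin (m + 2) → ℝ) ≃ₗ[ℝ] (Fin (m + 2) → ℝ)
  | 0 => LinearEquiv.refl ℝ _
  | r + 1 => (abelEquiv ℝ m (n r)).trans (AbelEquiv n r)

theorem AbelEquiv_succ_apply (n : ℕ → ℕ) (r : ℕ) (c : Fin (m + 2) → ℝ) :
    AbelEquiv n (r + 1) c = AbelEquiv n r (abel (n r) c) := rfl

theorem AbelEquiv_succ_symm (n : ℕ → ℕ) (r : ℕ) (c : Fin (m + 2) → ℝ) :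
    (AbelEquiv n (r + 1)).symm c = abelInv (n r) ((AbelEquiv n r).symm c) := rfl

theorem AbelEquiv_det (n : ℕ → ℕ) (r : ℕ) :
    |LinearMap.det (AbelEquiv (m := m) n r).toLinearMap| = 1 := by
  induction r with
  | zero => simp [AbelEquiv]
  | succ r ih =>
    rw [AbelEquiv, LinearEquiv.coe_trans, LinearMap.det_comp, abs_mul, ih, abelEquiv_det, mul_one]

theorem counts_LamW (n : ℕ → ℕ) (r : ℕ) (l : List (Fin (m + 2))) :
    counts (LamW n r l) = AbelEquiv n r (counts l) := by
  induction r generalizing l with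
  | zero => rfl
  | succ r ih => rw [LamW, ih, counts_lamW]; rfl

theorem abel_nonneg (n : ℕ) {c : Fin (m + 2) → ℝ} (h : ∀ i, 0 ≤ c i) (i : Fin (m + 2)) :
    0 ≤ abel n c i := by
  simp only [abel]
  have h1 := h (penult m)
  have h2 := h (Fin.last (m + 1))
  split_ifs
  · positivity
  · exact h _
  · positivity

/-- Each `abel` has nonnegative entries, so nonnegativity at a later stage pushes forward to earlier
ones: the cones are nested. -/
theorem AbelEquiv_symm_nonneg_of_le (n : ℕ → ℕ) {r s : ℕ} (hrs : r ≤ s) {c : Fin (m + 2) → ℝ}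
    (h : ∀ i, 0 ≤ (AbelEquiv n s).symm c i) : ∀ i, 0 ≤ (AbelEquiv n r).symm c i := by
  induction s, hrs using Nat.le_induction with
  | base => exact h
  | succ s hrs ih =>
    refine ih ?_
    have e : (AbelEquiv n s).symm c = abel (n s) ((AbelEquiv n (s + 1)).symm c) := by
      rw [AbelEquiv_succ_symm, ← abelEquiv_symm_apply, ← abelEquiv_apply,
        LinearEquiv.apply_symm_apply]
    rw [e]
    exact abel_nonneg _ h

end Counting

/-! ### Sublinear error terms and asymptotic proportions. -/

section Proportions

variable {m : ℕ}

/-- Functions `ℕ → ℝ` of sublinear growth. -/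
def SubLin (f : ℕ → ℝ) : Prop := ∀ ε > 0, ∃ C, ∀ t : ℕ, |f t| ≤ ε * t + C

theorem subLin_iff_tendsto {f : ℕ → ℝ} {a : ℝ} :
    SubLin (fun t => f t - t * a) ↔ Tendsto (fun t : ℕ => f t / t) atTop (𝓝 a) := by
  constructor
  · intro h
    rw [Metric.tendsto_atTop]
    intro ε hε
    obtain ⟨C, hC⟩ := h (ε / 2) (by positivity)
    obtain ⟨N, hN⟩ := exists_nat_gt (2 * C / ε)
    refine ⟨N + 1, fun t ht => ?_⟩
    have ht' : (N : ℝ) + 1 ≤ t := by exact_mod_cast ht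
    have ht0 : (0 : ℝ) < t := lt_of_lt_of_le (by positivity) ht'
    rw [Real.dist_eq, show f t / t - a = (f t - t * a) / t by field_simp, abs_div, abs_of_pos ht0,
      div_lt_iff₀ ht0]
    rw [div_lt_iff₀ hε] at hN
    have := hC t
    nlinarith
  · intro h ε hε
    rw [Metric.tendsto_atTop] at h
    obtain ⟨N, hN⟩ := h ε hε
    refine ⟨∑ s ∈ Finset.range (N + 1), |f s - s * a|, fun t => ?_⟩
    have hS : 0 ≤ ∑ s ∈ Finset.range (N + 1), |f s - s * a| :=
      Finset.sum_nonneg fun _ _ => abs_nonneg _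
    rcases Nat.lt_or_ge t (N + 1) with ht | ht
    · have := Finset.single_le_sum (f := fun s : ℕ => |f s - s * a|)
        (fun _ _ => abs_nonneg _) (Finset.mem_range.2 ht)
      have : 0 ≤ ε * t := by positivity
      linarith
    · have h1 := hN t (by omega)
      have ht0 : (0 : ℝ) < t := by exact_mod_cast (by omega : 0 < t)
      rw [Real.dist_eq, show f t / t - a = (f t - t * a) / t by field_simp, abs_div,
        abs_of_pos ht0, div_lt_iff₀ ht0] at h1
      linarith

theorem SubLin.add {f g : ℕ → ℝ} (hf : SubLin f) (hg : SubLin g) : SubLin fun t => f t + g t := by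
  intro ε hε
  obtain ⟨C, hC⟩ := hf (ε / 2) (by positivity)
  obtain ⟨D, hD⟩ := hg (ε / 2) (by positivity)
  refine ⟨C + D, fun t => (abs_add_le _ _).trans ?_⟩
  linarith [hC t, hD t]

theorem SubLin.const_mul {f : ℕ → ℝ} (hf : SubLin f) (a : ℝ) : SubLin fun t => a * f t := by
  intro ε hε
  obtain ⟨C, hC⟩ := hf (ε / (|a| + 1)) (by positivity)
  refine ⟨|a| * C, fun t => ?_⟩
  rw [abs_mul]
  calc |a| * |f t| ≤ |a| * (ε / (|a| + 1) * t + C) := by gcongr; exact hC t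
    _ = (|a| / (|a| + 1)) * (ε * t) + |a| * C := by ring
    _ ≤ 1 * (ε * t) + |a| * C := by
      gcongr
      rw [div_le_one (by positivity)]; linarith
    _ = _ := by ring

theorem SubLin.sub {f g : ℕ → ℝ} (hf : SubLin f) (hg : SubLin g) : SubLin fun t => f t - g t := by
  convert hf.add (hg.const_mul (-1)) using 2
  ring

theorem subLin_zero : SubLin fun _ => 0 := fun ε hε => ⟨0, fun t => by simp; positivity⟩

theorem SubLin.sum {ι : Type*} {s : Finset ι} {f : ι → ℕ → ℝ} (h : ∀ i ∈ s, SubLin (f i)) :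
    SubLin fun t => ∑ i ∈ s, f i t := by
  classical
  induction s using Finset.induction_on with
  | empty => simpa using subLin_zero
  | insert a s ha ih =>
    simp only [Finset.sum_insert ha]
    exact (h a (by simp)).add (ih fun i hi => h i (by simp [hi]))

theorem SubLin.comp {f : ℕ → ℝ} (hf : SubLin f) {p : ℕ → ℕ} {a b : ℝ} (ha : 0 < a)
    (hp : ∀ t, (p t : ℝ) ≤ a * t + b) : SubLin fun t => f (p t) := by
  intro ε hε
  obtain ⟨C, hC⟩ := hf (ε / a) (by positivity)
  refine ⟨ε / a * b + C, fun t => (hC _).trans ?_⟩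
  calc ε / a * p t + C ≤ ε / a * (a * t + b) + C := by gcongr; exact hp t
    _ = _ := by field_simp; ring

theorem SubLin.of_abs_le {f g : ℕ → ℝ} (hg : SubLin g) (C : ℝ) (h : ∀ t, |f t| ≤ |g t| + C) :
    SubLin f := by
  intro ε hε
  obtain ⟨D, hD⟩ := hg ε hε
  exact ⟨D + C, fun t => by linarith [h t, hD t]⟩

theorem proportions_eq (x : ℕ → Fin (m + 2)) (t : ℕ) (i : Fin (m + 2)) :
    proportions (toLex x) t i = counts (pre x t) i / t := by
  rw [proportions, counts]
  congr 2
  change ((Finset.range t).filter fun s => x s = i).card = _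
  induction t with
  | zero => simp
  | succ t ih =>
    rw [pre_succ, List.count_append, ← ih, Finset.range_add_one, Finset.filter_insert]
    simp only [List.count_singleton, beq_iff_eq]
    split_ifs <;> simp

theorem mem_sequencesWithProportions_iff {x : ℕ → Fin (m + 2)} {α : Fin (m + 2) → ℝ} :
    toLex x ∈ sequencesWithProportions α ↔
      ∀ i, SubLin fun t => counts (pre x t) i - t * α i := by
  simp only [sequencesWithProportions, Set.mem_ofPred_eq, tendsto_pi_nhds, proportions_eq,
    subLin_iff_tendsto]

theorem counts_le_length (l : List (Fin (m + 2))) (i) : counts l i ≤ l.length :=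
  Nat.cast_le.2 List.count_le_length

/-- Prepending a finite word does not change the proportions. -/
theorem app_mem_sequencesWithProportions {x : ℕ → Fin (m + 2)} {α : Fin (m + 2) → ℝ}
    (l : List (Fin (m + 2))) (hα : ∀ i, |α i| ≤ 1) (h : toLex x ∈ sequencesWithProportions α) :
    toLex (app l x) ∈ sequencesWithProportions α := by
  rw [mem_sequencesWithProportions_iff] at h ⊢
  intro i
  have h1 := (h i).comp (p := fun t => t - l.length) (a := 1) (b := 0) one_pos
    fun t => by simp
  refine h1.of_abs_le (2 * l.length) fun t => ?_
  have hl := abs_le.1 (hα i)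
  rcases Nat.lt_or_ge t l.length with ht | ht
  · have e1 := counts_le_length (pre (app l x) t) i
    have e2 := counts_nonneg (pre (app l x) t) i
    rw [length_pre] at e1
    have e3 : (t : ℝ) ≤ l.length := by exact_mod_cast ht.le
    have e4 : (0 : ℝ) ≤ t := by positivity
    have e5 := abs_nonneg (counts (pre x (t - l.length)) i - ((t - l.length : ℕ) : ℝ) * α i)
    rw [abs_le]
    constructor <;> nlinarith
  · obtain ⟨s, rfl⟩ := Nat.exists_eq_add_of_le ht
    rw [pre_app, counts_append, Nat.add_sub_cancel_left, Pi.add_apply]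
    push_cast
    rw [show counts l i + counts (pre x s) i - (↑l.length + ↑s) * α i =
      (counts (pre x s) i - s * α i) + (counts l i - l.length * α i) by ring]
    refine (abs_add_le _ _).trans ?_
    gcongr
    have e1 := counts_le_length l i
    have e2 := counts_nonneg l i
    have e4 : (0 : ℝ) ≤ l.length := by positivity
    rw [abs_le]
    constructor <;> nlinarith

/-- If the letter counts of the images of long prefixes are nearly proportional to `γ`, then
the substituted sequence has proportions `γ`. -/
theorem subLin_of_blocks {W : List (Fin (m + 2)) → List (Fin (m + 2))}
    {φ : (ℕ → Fin (m + 2)) → (ℕ → Fin (m + 2))} {x : ℕ → Fin (m + 2)} {γ : ℝ} {i : Fin (m + 2)}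
    (hW0 : W [] = []) (hW : ∀ l l', W (l ++ l') = W l ++ W l') (hne : ∀ a, 0 < (W [a]).length)
    (hφ : ∀ l y, φ (app l y) = app (W l) (φ y)) {ε : ℝ} (hε : 0 < ε) (hγ : |γ| ≤ 1)
    (h : ∃ C, ∀ N, |counts (W (pre x N)) i - (W (pre x N)).length * γ| ≤
      ε * (W (pre x N)).length + C) :
    ∃ C, ∀ t : ℕ, |counts (pre (φ x) t) i - t * γ| ≤ ε * t + C := by
  obtain ⟨C, hC⟩ := h
  obtain ⟨M, hM⟩ : ∃ M, ∀ a, (W [a]).length ≤ M :=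
    ⟨∑ a, (W [a]).length, fun a => Finset.single_le_sum (f := fun a => (W [a]).length)
      (fun _ _ => Nat.zero_le _) (Finset.mem_univ a)⟩
  -- A position `t` exceeds a union of complete blocks by at most `M` letters, which alter the
  -- discrepancy by at most `2 * M` because `|γ| ≤ 1`.
  refine ⟨C + 2 * M, fun t => ?_⟩
  have hmono : StrictMono fun N => (W (pre x N)).length := by
    refine strictMono_nat_of_lt_succ fun N => ?_
    rw [pre_succ, hW, List.length_append]
    have := hne (x N)
    omega
  obtain ⟨N, h1, h2⟩ := exists_between hmono (by simp [hW0]) t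
  rw [pre_succ, hW, List.length_append] at h2
  obtain ⟨s, rfl⟩ := Nat.exists_eq_add_of_le h1
  have hs : s ≤ M := by have := hM (x N); omega
  have hs' : (s : ℝ) ≤ M := by exact_mod_cast hs
  have e : φ x = app (W (pre x N)) (φ (tail N x)) := by rw [← hφ, app_pre_tail]
  rw [e, pre_app, counts_append, Pi.add_apply]
  set l := W (pre x N)
  set l' := pre (φ (tail N x)) s
  have hl' : (l'.length : ℝ) = s := by simp [l']
  have e1 := counts_le_length l' i
  have e2 := counts_nonneg l' i
  rw [hl'] at e1
  have e4 : (0 : ℝ) ≤ s := by positivity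
  push_cast
  rw [show counts l i + counts l' i - (↑l.length + ↑s) * γ =
      (counts l i - l.length * γ) + (counts l' i - s * γ) by ring]
  refine (abs_add_le _ _).trans ?_
  have hγ' := abs_le.1 hγ
  have e5 : |counts l' i - s * γ| ≤ 2 * M := by
    rw [abs_le]
    constructor <;> nlinarith
  have := hC N
  nlinarith

end Proportions

/-! ### The continued fraction map as the inverse of the substitutions on proportions. -/

section ContinuedFraction

variable {m : ℕ}

theorem fst_eq : fst (m + 2) = 0 := rfl

theorem lst_eq : lst (m + 2) = Fin.last (m + 1) := rfl

theorem Kn_eq (n : ℕ) (α : Fin (m + 2) → ℝ) : Kn n α = (1 - α 0)⁻¹ • abelInv n α := by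
  funext i
  rw [Pi.smul_apply, smul_eq_mul, inv_mul_eq_div, Kn, fst_eq, lst_eq]
  congr 1
  simp [abelInv]

theorem K_mem {α : Fin (m + 2) → ℝ} (h : α ∈ Delta (m + 2)) : K α ∈ Delta (m + 2) :=
  mapsTo_K (by omega) h

theorem abs_le_one_of_mem {α : Fin (m + 2) → ℝ} (h : α ∈ Delta (m + 2)) (i) : |α i| ≤ 1 := by
  rw [abs_of_nonneg (h.1 i), ← h.2.2]
  exact Finset.single_le_sum (fun j _ => h.1 j) (Finset.mem_univ i)

theorem coord_zero_lt_one {α : Fin (m + 2) → ℝ} (h : α ∈ Delta (m + 2)) : α 0 < 1 := by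
  have h1 := h.2.2
  have h2 := h.2.1
  rw [lst_eq] at h2
  rw [sum_split] at h1
  have : 0 ≤ ∑ i : Fin m, α ⟨i.val + 1, by omega⟩ := Finset.sum_nonneg fun i _ => h.1 _
  linarith

theorem abel_K {α : Fin (m + 2) → ℝ} : abel (J α) (K α) = (1 - α 0)⁻¹ • α := by
  rw [K, Kn_eq, ← abelEquiv_apply, map_smul, ← abelEquiv_symm_apply, LinearEquiv.apply_symm_apply]

theorem lam_mem_sequencesWithProportions {α : Fin (m + 2) → ℝ} (h : α ∈ Delta (m + 2))
    {x : ℕ → Fin (m + 2)} (hx : toLex x ∈ sequencesWithProportions (K α)) :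
    toLex (lam (J α) x) ∈ sequencesWithProportions α := by
  rw [mem_sequencesWithProportions_iff] at hx ⊢
  intro i ε hε
  let A := abelEquiv ℝ m (J α)
  -- `G` is the excess of the letter `i` in the substituted word over what `α` prescribes. It is
  -- linear in the counts of the original word and vanishes at `K α`, so sublinear errors in those
  -- counts yield a sublinear excess.
  let G : (Fin (m + 2) → ℝ) →ₗ[ℝ] ℝ := (LinearMap.proj i - α i • ∑ j, LinearMap.proj j) ∘ₗ
    (A : (Fin (m + 2) → ℝ) →ₗ[ℝ] (Fin (m + 2) → ℝ))
  have hG : ∀ c, G c = abel (J α) c i - (∑ j, abel (J α) c j) * α i := by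
    intro c
    simp [G, A, mul_comm]
  have hGK : G (K α) = 0 := by
    rw [hG, abel_K]
    simp only [Pi.smul_apply, smul_eq_mul, ← Finset.mul_sum, h.2.2]
    ring
  have hsub : SubLin fun N => G (counts (pre x N)) := by
    have h1 : ∀ N : ℕ, G (counts (pre x N)) =
        ∑ j, G (Pi.single j 1) * (counts (pre x N) j - N * K α j) := by
      intro N
      have e : G (counts (pre x N)) = G (counts (pre x N) - (N : ℝ) • K α) := by
        rw [map_sub, map_smul, hGK]; simp
      rw [e, LinearMap.pi_apply_eq_sum_univ]
      refine Finset.sum_congr rfl fun j _ => ?_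
      rw [smul_eq_mul, mul_comm]
      congr 2
      funext l
      simp [Pi.single_apply, eq_comm]
    simp only [h1]
    exact SubLin.sum fun j _ => (hx j).const_mul _
  refine subLin_of_blocks (W := lamW (J α)) rfl (lamW_append _) (fun a => ?_) (lam_app _) hε
    (abs_le_one_of_mem h i) ?_
  · simp [lamW, length_blk]
  obtain ⟨C, hC⟩ := hsub ε hε
  refine ⟨C, fun N => ?_⟩
  rw [counts_lamW, ← sum_counts, counts_lamW, ← hG, ← counts_lamW, sum_counts]
  refine (hC N).trans ?_
  gcongr
  exact (strictMono_length_lamW (J α) x).le_apply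

theorem lam_mem_maximalSequences {α : Fin (m + 2) → ℝ} (h : α ∈ Delta (m + 2))
    {x : ℕ → Fin (m + 2)} (hx : toLex x ∈ maximalSequences (K α)) :
    toLex (lam (J α) x) ∈ maximalSequences α :=
  ⟨lam_isMaximal _ hx.1, lam_mem_sequencesWithProportions h hx.2⟩

theorem Phi_zero (α : Fin (m + 2) → ℝ) : Phi α 0 = J α := rfl

theorem tail_Phi (α : Fin (m + 2) → ℝ) : tail 1 (Phi α) = Phi (K α) := by
  funext r
  simp [Phi, add_comm 1 r]

end ContinuedFraction

/-! ### Maximal sequences with prescribed proportions. -/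

section Existence

variable {m : ℕ}

/-- The letters chosen greedily so as to have the proportions `β`, as a function of the vector of
deficits of the letters. -/
theorem exists_bounded_discrepancy {β : Fin (m + 2) → ℝ} (h0 : ∀ i, 0 ≤ β i) (h1 : ∑ i, β i = 1) :
    ∃ v : ℕ → Fin (m + 2), ∀ N i, |counts (pre v N) i - N * β i| ≤ m + 2 := by
  have hmax : ∀ D : Fin (m + 2) → ℝ, ∃ i, ∀ j, D j + β j ≤ D i + β i := fun D =>
    Finite.exists_max fun j => D j + β j
  choose c hc using hmax
  let D : ℕ → Fin (m + 2) → ℝ := fun N =>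
    Nat.rec 0 (fun _ E => E + β - Pi.single (c E) 1) N
  have hD : ∀ N, D (N + 1) = D N + β - Pi.single (c (D N)) 1 := fun N => rfl
  let v : ℕ → Fin (m + 2) := fun N => c (D N)
  have hcount : ∀ N, D N = (N : ℝ) • β - counts (pre v N) := by
    intro N
    induction N with
    | zero => simp [D]
    | succ N ih =>
      rw [hD, pre_succ, counts_append, counts_singleton]
      nth_rewrite 1 [ih]
      push_cast
      rw [add_smul, one_smul]
      abel_nf
      rfl
  have hsum : ∀ N, ∑ i, D N i = 0 := by
    intro N
    rw [hcount]
    simp [Finset.sum_sub_distrib, ← Finset.mul_sum, h1, sum_counts]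
  -- After adding `β` the deficits sum to `1`, so the greatest of them is nonnegative and can lose
  -- `1` without falling below `-1`. The upper bound comes afterwards from the vanishing of the sum
  -- of the deficits.
  have hlow : ∀ N i, -1 ≤ D N i := by
    intro N
    induction N with
    | zero => intro i; simp [D]
    | succ N ih =>
      intro i
      rw [hD]
      by_cases hi : i = c (D N)
      · have : 0 ≤ D N i + β i := by
          by_contra hneg
          have hall : ∀ j ∈ Finset.univ, D N j + β j < 0 := fun j _ =>
            (hc (D N) j).trans_lt (by rw [← hi]; exact not_le.1 hneg)
          have := Finset.sum_lt_sum_of_nonempty Finset.univ_nonempty hall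
          rw [Finset.sum_add_distrib, hsum, h1] at this
          simp at this
          linarith
        simp [← hi]; linarith
      · have := h0 i
        simp [hi]
        linarith [ih i]
  refine ⟨v, fun N i => ?_⟩
  have e : counts (pre v N) i - N * β i = - D N i := by rw [hcount]; simp
  rw [e, abs_neg, abs_le]
  refine ⟨by linarith [hlow N i, (Nat.cast_nonneg m : (0 : ℝ) ≤ m)], ?_⟩
  have h2 := hsum N
  rw [← Finset.add_sum_erase _ _ (Finset.mem_univ i)] at h2
  have h3 : ∑ j ∈ Finset.univ.erase i, (-1 : ℝ) ≤ ∑ j ∈ Finset.univ.erase i, D N j :=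
    Finset.sum_le_sum fun j _ => hlow N j
  simp only [Finset.sum_const, Finset.card_erase_of_mem (Finset.mem_univ i), Finset.card_univ,
    Fintype.card_fin, nsmul_eq_mul] at h3
  push_cast at h3
  linarith

/-- Every proper tail meets a smaller letter while the sequence itself is still in its initial run
of largest letters. -/
theorem isMaximalSeq_of_runs {w : ℕ → Fin (m + 2)} {R : ℕ} (hR : ∀ i < R, w i = Fin.last (m + 1))
    (h : ∀ r, 0 < r → ∃ i < R, w (r + i) ≠ Fin.last (m + 1)) : IsMaximalSeq (toLex w) := by
  rw [isMaximalSeq_iff]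
  intro r
  rcases Nat.eq_zero_or_pos r with rfl | hr
  · simp
  have hex : ∃ i, w (r + i) ≠ Fin.last (m + 1) := (h r hr).imp fun _ h => h.2
  obtain ⟨i, hi, hwi⟩ := h r hr
  classical
  have hlt : Nat.find hex < R := (Nat.find_min' hex hwi).trans_lt hi
  refine (toLex_lt_iff.2 ⟨Nat.find hex, fun j hj => ?_, ?_⟩).le
  · rw [hR j (by omega), tail_apply]
    exact not_not.1 (Nat.find_min hex hj)
  · rw [hR _ hlt, tail_apply]
    exact lt_of_le_of_ne (Fin.le_last _) (Nat.find_spec hex)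

/-- In a sequence of bounded discrepancy the runs of the largest letter are bounded unless it is the
only letter with positive proportion. Prepending a longer run gives maximality and does not affect
proportions. -/
theorem maximalSequences_nonempty {β : Fin (m + 2) → ℝ} (hβ : β ∈ Delta (m + 2)) :
    ∃ w : ℕ → Fin (m + 2), toLex w ∈ maximalSequences β := by
  by_cases hj : ∃ j, j ≠ Fin.last (m + 1) ∧ 0 < β j
  · obtain ⟨j, hjl, hj⟩ := hj
    obtain ⟨v, hv⟩ := exists_bounded_discrepancy hβ.1 hβ.2.2
    have hvp : toLex v ∈ sequencesWithProportions β := by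
      rw [mem_sequencesWithProportions_iff]
      intro i ε hε
      refine ⟨m + 2, fun t => (hv t i).trans ?_⟩
      have : 0 ≤ ε * t := by positivity
      linarith
    -- Two discrepancies of at most `m + 2` cannot cancel `g * β j`, so every window of length `g`
    -- contains the letter `j`.
    obtain ⟨g, hg⟩ := exists_nat_gt (2 * (m + 2) / β j)
    rw [div_lt_iff₀ hj] at hg
    have hwin : ∀ r, ∃ i < g, v (r + i) ≠ Fin.last (m + 1) := by
      intro r
      have h1 := (abs_le.1 (hv (r + g) j)).1
      have h2 := (abs_le.1 (hv r j)).2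
      rw [pre_add, counts_append, Pi.add_apply] at h1
      push_cast at h1
      have h3 : 0 < counts (pre (tail r v) g) j := by linarith
      simp only [counts, Nat.cast_pos, List.count_pos_iff, pre, List.mem_map, List.mem_range,
        tail_apply] at h3
      obtain ⟨i, hi, hij⟩ := h3
      exact ⟨i, hi, by rw [hij]; exact hjl⟩
    set l := List.replicate g (Fin.last (m + 1))
    have hl : l.length = g := by simp [l]
    refine ⟨app l v, ?_, app_mem_sequencesWithProportions _ (abs_le_one_of_mem hβ) hvp⟩
    have hw1 : ∀ i < g, app l v i = Fin.last (m + 1) := by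
      intro i hi
      have h1 : pre (app l v) g = pre (fun _ => Fin.last (m + 1)) g := by
        rw [← hl, pre_app_length, hl]; simp [l, pre]
      exact pre_eq_iff.1 h1 i hi
    have hw2 : ∀ t, app l v (g + t) = v t := fun t => by
      conv_lhs => rw [← hl]
      exact app_apply_add l v t
    have hex : ∃ R, app l v R ≠ Fin.last (m + 1) := by
      obtain ⟨i, -, hi⟩ := hwin 0
      exact ⟨g + i, by rw [hw2]; simpa using hi⟩
    classical
    have hgR : g ≤ Nat.find hex := by
      by_contra hlt
      exact Nat.find_spec hex (hw1 _ (by omega))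
    refine isMaximalSeq_of_runs (R := Nat.find hex)
      (fun i hi => not_not.1 (Nat.find_min hex hi)) fun r hr => ?_
    -- A tail starting within the initial run, or where it ends, meets its end at position `Nat.find
    -- hex`; a later tail starts inside `v`, where windows of length `g` apply.
    rcases le_or_gt r (Nat.find hex) with hle | hgt
    · refine ⟨Nat.find hex - r, by omega, ?_⟩
      rw [Nat.add_sub_cancel' hle]
      exact Nat.find_spec hex
    · obtain ⟨i, hi, hne⟩ := hwin (r - g)
      refine ⟨i, by omega, ?_⟩
      rw [show r + i = g + (r - g + i) by omega, hw2]
      exact hne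
  · push Not at hj
    have hz : ∀ j, j ≠ Fin.last (m + 1) → β j = 0 := fun j h => le_antisymm (hj j h) (hβ.1 j)
    have hβ' : β = Pi.single (Fin.last (m + 1)) 1 := by
      have h1 := hβ.2.2
      rw [Finset.sum_eq_single (Fin.last (m + 1)) (fun j _ h => hz j h) (by simp)] at h1
      funext j
      by_cases h : j = Fin.last (m + 1)
      · rw [h, h1]; simp
      · rw [hz j h]; simp [h]
    refine ⟨fun _ => Fin.last (m + 1), isMaximalSeq_iff.2 fun _ => le_rfl, ?_⟩
    rw [mem_sequencesWithProportions_iff]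
    intro i
    convert subLin_zero using 2 with t
    have : counts (pre (fun _ => Fin.last (m + 1)) t) = (t : ℝ) • β := by
      induction t with
      | zero => simp
      | succ t ih => rw [pre_succ, counts_append, ih, counts_singleton, ← hβ']; push_cast; module
    rw [this]; simp

theorem exists_Lam_mem_maximalSequences (r : ℕ) {α : Fin (m + 2) → ℝ} (h : α ∈ Delta (m + 2)) :
    ∃ x, toLex (Lam (Phi α) r x) ∈ maximalSequences α := by
  induction r generalizing α with
  | zero => exact maximalSequences_nonempty h
  | succ r ih =>
    obtain ⟨x, hx⟩ := ih (K_mem h)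
    refine ⟨x, ?_⟩
    rw [Lam_succ', tail_Phi]
    exact lam_mem_maximalSequences h hx

end Existence

/-! ### Desubstitution by matching smallest letters with largest letters. -/

section Desubstitution

variable {m : ℕ}

/-- The excess of `n + 1` times the number of largest letters over the number of smallest letters
among the first `t` letters of `w`. -/
def height (n : ℕ) (w : ℕ → Fin (m + 2)) (t : ℕ) : ℤ :=
  (n + 1) * ((pre w t).count (Fin.last (m + 1)) : ℤ) - ((pre w t).count 0 : ℤ)

/-- The positions of largest letters from which on the height increases. -/
def Unmatched (n : ℕ) (w : ℕ → Fin (m + 2)) (q : ℕ) : Prop :=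
  w q = Fin.last (m + 1) ∧ ∀ s > q, height n w q < height n w s

open scoped Classical in
/-- The number of unmatched positions before `t`. -/
noncomputable def unmatchedCount (n : ℕ) (w : ℕ → Fin (m + 2)) (t : ℕ) : ℕ :=
  Nat.count (Unmatched n w) t

open scoped Classical in
/-- The letter of the desubstituted sequence that comes from the letter at position `q`. -/
noncomputable def code (n : ℕ) (w : ℕ → Fin (m + 2)) (q : ℕ) : Fin (m + 2) :=
  if w q = Fin.last (m + 1) then if Unmatched n w q then Fin.last (m + 1) else penult m
  else ⟨(w q).val - 1, by omega⟩

/-- The number of letters other than the smallest among the first `t` letters of `w`. -/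
def nzCount (w : ℕ → Fin (m + 2)) (t : ℕ) : ℕ := Nat.count (fun s => w s ≠ 0) t

/-- The desubstituted sequence: the smallest letters are deleted, and each one that was deleted
accounts for a matched largest letter. -/
noncomputable def desub (n : ℕ) (w : ℕ → Fin (m + 2)) (j : ℕ) : Fin (m + 2) :=
  code n w (Nat.nth (fun s => w s ≠ 0) j)

variable {n : ℕ} {w : ℕ → Fin (m + 2)}

theorem zero_ne_last : (0 : Fin (m + 2)) ≠ Fin.last (m + 1) := by simp [Fin.ext_iff]

theorem penult_ne_last : penult m ≠ Fin.last (m + 1) := by simp [Fin.ext_iff]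

@[simp] theorem height_zero : height n w 0 = 0 := by simp [height]

theorem height_succ_of_last {t : ℕ} (h : w t = Fin.last (m + 1)) :
    height n w (t + 1) = height n w t + (n + 1) := by
  simp only [height, pre_succ, List.count_append, h, List.count_singleton_self,
    List.count_singleton, beq_iff_eq, zero_ne_last.symm, if_false]
  push_cast; ring

theorem height_succ_of_zero {t : ℕ} (h : w t = 0) :
    height n w (t + 1) = height n w t - 1 := by
  simp only [height, pre_succ, List.count_append, h, List.count_singleton_self,
    List.count_singleton, beq_iff_eq, zero_ne_last, if_false]
  push_cast; ring

theorem height_succ_le {t : ℕ} (h : w t ≠ Fin.last (m + 1)) :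
    height n w (t + 1) ≤ height n w t := by
  simp only [height, pre_succ, List.count_append, List.count_singleton, beq_iff_eq, h, if_false]
  push_cast
  have : (0 : ℤ) ≤ if w t = 0 then 1 else 0 := by split_ifs <;> simp
  linarith

theorem unmatchedCount_succ_of (t : ℕ) (h : Unmatched n w t) :
    unmatchedCount n w (t + 1) = unmatchedCount n w t + 1 := by
  classical
  rw [unmatchedCount, Nat.count_succ, if_pos h]; rfl

theorem unmatchedCount_succ_of_not (t : ℕ) (h : ¬ Unmatched n w t) :
    unmatchedCount n w (t + 1) = unmatchedCount n w t := by
  classical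
  rw [unmatchedCount, Nat.count_succ, if_neg h]; rfl

theorem unmatchedCount_mono : Monotone (unmatchedCount n w) := by
  classical exact Nat.count_monotone _

/-- Beyond an unmatched position the height stays at least one unit higher for good, so the height
increases by at least the number of unmatched positions passed. -/
theorem unmatchedCount_le {p t s : ℕ} (hp : Unmatched n w p) (hpt : p ≤ t) (hts : t ≤ s) :
    (unmatchedCount n w t : ℤ) - unmatchedCount n w p ≤ height n w s - height n w p := by
  induction t, hpt using Nat.le_induction generalizing s with
  | base =>
    rcases hts.eq_or_lt with rfl | h
    · simp
    · linarith [hp.2 s h]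
  | succ t hpt ih =>
    by_cases ht : Unmatched n w t
    · have h1 := ih le_rfl
      have h2 := ht.2 s (by omega)
      rw [unmatchedCount_succ_of t ht]
      push_cast
      linarith
    · rw [unmatchedCount_succ_of_not t ht]
      exact ih (by omega)

/-- The last time that the height is at most `ℓ` is an unmatched position. The `n` zeros that must
follow it bring the net gain of its largest letter down from `n + 1` to `1`, so no level is skipped,
and induction applies to the level just below. -/
theorem le_unmatchedCount (hrun : ∀ q, w q = Fin.last (m + 1) → ∀ i < n, w (q + 1 + i) = 0)
    (ℓ t : ℕ) (h : ∀ s ≥ t, (ℓ : ℤ) ≤ height n w s) : ℓ ≤ unmatchedCount n w t := by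
  induction ℓ generalizing t with
  | zero => simp
  | succ ℓ ih =>
    push_cast at h
    classical
    set q := Nat.findGreatest (fun s => height n w s ≤ ℓ) t with hq
    have hq1 : height n w q ≤ ℓ :=
      Nat.findGreatest_spec (P := fun s => height n w s ≤ ℓ) (Nat.zero_le t) (by simp)
    have hqt : q ≤ t := Nat.findGreatest_le t
    have hgt : ∀ s > q, (ℓ : ℤ) < height n w s := by
      intro s hs
      rcases le_or_gt s t with hst | hst
      · exact not_le.1 (Nat.findGreatest_is_greatest hs hst)
      · linarith [h s hst.le]
    have hqt' : q < t := by
      refine lt_of_le_of_ne hqt fun e => ?_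
      have := h q e.ge
      linarith
    have hlast : w q = Fin.last (m + 1) := by
      by_contra hne
      have h1 := height_succ_le (n := n) hne
      have h2 := hgt (q + 1) (by omega)
      linarith
    have hun : Unmatched n w q := ⟨hlast, fun s hs => hq1.trans_lt (hgt s hs)⟩
    have hdesc : ∀ i ≤ n, height n w (q + 1 + i) = height n w q + (n + 1) - i := by
      intro i hi
      induction i with
      | zero => simp [height_succ_of_last hlast]
      | succ i ih =>
        rw [← add_assoc, height_succ_of_zero (hrun q hlast i (by omega)), ih (by omega)]
        push_cast; ring
    -- After the run of zeros the height is `height n w q + 1`, and it already exceeds `ℓ` there.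
    have hℓ : (ℓ : ℤ) ≤ height n w q := by
      have h1 := hgt (q + 1 + n) (by omega)
      rw [hdesc n le_rfl] at h1
      linarith
    have h1 := ih q fun s hs => by
      rcases hs.eq_or_lt with rfl | hs
      · exact hℓ
      · exact (hgt s hs).le
    have h2 := unmatchedCount_succ_of q hun
    have h3 := unmatchedCount_mono (n := n) (w := w) (show q + 1 ≤ t by omega)
    omega

theorem hd_code {q : ℕ} (h : w q ≠ 0) : hd (code n w q) = w q := by
  have h0 : (w q).val ≠ 0 := fun e => h (Fin.ext e)
  have := (w q).isLt
  simp only [code]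
  split_ifs with h1 h2
  · rw [h1, hd_last]
  · rw [h1]; simp [hd, Fin.ext_iff]
  · ext; simp [hd]; omega

theorem nzCount_succ_of {t : ℕ} (h : w t ≠ 0) : nzCount w (t + 1) = nzCount w t + 1 := by
  rw [nzCount, Nat.count_succ, if_pos h]; rfl

theorem nzCount_succ_of_not {t : ℕ} (h : w t = 0) : nzCount w (t + 1) = nzCount w t := by
  rw [nzCount, Nat.count_succ, if_neg (by simpa using h)]; rfl

theorem desub_nzCount {t : ℕ} (h : w t ≠ 0) : desub n w (nzCount w t) = code n w t := by
  rw [desub, nzCount, Nat.nth_count (p := fun s => w s ≠ 0) h]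

theorem nzCount_add (p t : ℕ) :
    nzCount w (p + t) = nzCount w p + (pre (tail p w) t).countP (· ≠ 0) := by
  induction t with
  | zero => simp
  | succ t ih =>
    rw [← add_assoc, pre_succ, List.countP_append, ← add_assoc, ← ih, tail_apply]
    by_cases h : w (p + t) = 0
    · rw [nzCount_succ_of_not h]; simp [h]
    · rw [nzCount_succ_of h]; simp [h]

theorem countP_lamW (l : List (Fin (m + 2))) : (lamW n l).countP (· ≠ 0) = l.length := by
  induction l with
  | nil => rfl
  | cons a l ih =>
    rw [show a :: l = [a] ++ l from rfl, lamW_append, List.countP_append, ih]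
    have : (lamW n [a]).countP (· ≠ 0) = 1 := by
      simp [lamW, blk, (hd_pos a).ne', List.countP_replicate]
    rw [this, List.length_append, List.length_singleton]

/-- This and the next two results are the coordinates of `abelInv`, with the exact count of
unmatched positions in the role of `(n + 1) * a (Fin.last (m + 1)) - a 0`. -/
theorem counts_desub_mid (j : ℕ) (hj : j < m) (t : ℕ) :
    (pre (desub n w) (nzCount w t)).count ⟨j, by omega⟩ = (pre w t).count ⟨j + 1, by omega⟩ := by
  induction t with
  | zero => rfl
  | succ t ih =>
    rw [pre_succ, List.count_append, ← ih]
    by_cases h : w t = 0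
    · rw [nzCount_succ_of_not h, h, List.count_singleton, if_neg (by simp [Fin.ext_iff]),
        add_zero]
    · rw [nzCount_succ_of h, pre_succ, List.count_append, desub_nzCount h]
      congr 1
      simp only [List.count_singleton, beq_iff_eq]
      congr 1
      rw [← hd_code (n := n) h]
      have := (code n w t).isLt
      simp only [hd, Fin.ext_iff, eq_iff_iff]
      omega

theorem counts_desub_last (t : ℕ) :
    (pre (desub n w) (nzCount w t)).count (Fin.last (m + 1)) = unmatchedCount n w t := by
  classical
  induction t with
  | zero => simp [nzCount, unmatchedCount]
  | succ t ih =>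
    by_cases h : w t = 0
    · rw [nzCount_succ_of_not h, ih, unmatchedCount_succ_of_not]
      exact fun hu => zero_ne_last (h.symm.trans hu.1)
    · rw [nzCount_succ_of h, pre_succ, List.count_append, desub_nzCount h, ih]
      by_cases hu : Unmatched n w t
      · rw [unmatchedCount_succ_of t hu]
        simp [code, hu, hu.1]
      · rw [unmatchedCount_succ_of_not t hu, List.count_singleton, if_neg, add_zero]
        have := (w t).isLt
        simp only [code, hu, if_false, beq_iff_eq]
        split_ifs with h1
        · exact penult_ne_last
        · simp only [Fin.ext_iff, Fin.val_last] at h1 ⊢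
          omega

theorem counts_desub_penult (t : ℕ) :
    (pre (desub n w) (nzCount w t)).count (penult m) + unmatchedCount n w t =
      (pre w t).count (Fin.last (m + 1)) := by
  classical
  induction t with
  | zero => simp [nzCount, unmatchedCount]
  | succ t ih =>
    rw [pre_succ, List.count_append, ← ih]
    by_cases h : w t = 0
    · rw [nzCount_succ_of_not h, unmatchedCount_succ_of_not, h, List.count_singleton,
        if_neg (by simp), add_zero]
      exact fun hu => zero_ne_last (h.symm.trans hu.1)
    · rw [nzCount_succ_of h, pre_succ, List.count_append, desub_nzCount h]
      by_cases hl : w t = Fin.last (m + 1)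
      · by_cases hu : Unmatched n w t
        · rw [unmatchedCount_succ_of t hu]
          simp only [code, hu, hl, if_true, List.count_singleton_self, List.count_singleton,
            beq_iff_eq, penult_ne_last.symm, if_false]
          ring
        · rw [unmatchedCount_succ_of_not t hu]
          simp only [code, hu, hl, if_true, List.count_singleton_self, if_false]
          ring
      · rw [unmatchedCount_succ_of_not t fun hu => hl hu.1]
        have := (w t).isLt
        have hne : code n w t ≠ penult m := by
          simp only [Fin.ext_iff, Fin.val_last] at hl
          simp only [code, Fin.ext_iff, Fin.val_last, if_neg hl]
          have h0 : (w t).val ≠ 0 := fun e => h (Fin.ext e)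
          intro he
          rw [Fin.ext_iff] at he
          change (w t).val - 1 = m at he
          clear h
          omega
        simp [hne, hl]

/-- At a first position where the image is larger, the image cannot be at a `0` inside a block, so a
block starts there. If `w` were nonzero at that place, the letters would agree by `hd_code`; so `w`
has a `0` too many, and the height drops below what the unmatched positions since `p` guarantee. -/
theorem lam_desub_le {p : ℕ} (hp : Unmatched n w p) :
    toLex (lam n (tail (nzCount w p) (desub n w))) ≤ toLex (tail p w) := by
  by_contra hlt
  obtain ⟨t, heq, hgt⟩ := toLex_lt_iff.1 (not_le.1 hlt)
  set v := tail (nzCount w p) (desub n w) with hv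
  obtain ⟨N, s, rfl, hs⟩ := exists_block n v t
  have hxt : lam n v ((lamW n (pre v N)).length + s) = lam n (tail N v) s := by
    have := congrFun (tail_lam n v N s) 0
    simpa using this
  rcases s with _ | s
  swap
  · rw [hxt, lam_apply_succ_of_lt] at hgt
    · exact absurd hgt (by simp)
    · rw [length_blk] at hs; simpa using hs
  rw [add_zero] at *
  set l := lamW n (pre v N) with hl
  have hlx : pre (tail p w) l.length = l := by
    rw [pre_eq_iff.2 heq, lam_eq_app_pre n v N, pre_app_length]
  have hnz : nzCount w (p + l.length) = nzCount w p + N := by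
    rw [nzCount_add, hlx, hl, countP_lamW, length_pre]
  have hy : w (p + l.length) = 0 := by
    by_contra hne
    have h1 := desub_nzCount (n := n) hne
    rw [hnz] at h1
    rw [hxt, lam_zero, tail_apply, tail_apply, hv, tail_apply, add_zero, h1, hd_code hne] at hgt
    exact lt_irrefl _ hgt
  have hcnt := counts_lamW n (pre v N)
  have hc0 := congrFun hcnt 0
  have hcl := congrFun hcnt (Fin.last (m + 1))
  rw [abel_zero] at hc0
  rw [abel_last] at hcl
  simp only [counts] at hc0 hcl
  norm_cast at hc0 hcl
  rw [← hl] at hc0 hcl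
  have hu : unmatchedCount n w (p + l.length) = unmatchedCount n w p +
      (pre v N).count (Fin.last (m + 1)) := by
    rw [← counts_desub_last, hnz, pre_add, List.count_append, counts_desub_last]
  have hh : height n w (p + l.length + 1) = height n w p +
      (n + 1) * (l.count (Fin.last (m + 1)) : ℤ) - (l.count 0 : ℤ) - 1 := by
    rw [height_succ_of_zero hy, height, pre_add, hlx, List.count_append, List.count_append, height]
    push_cast; ring
  -- The left side is the number of largest letters in `pre v N`; by the abelianization the right
  -- side is that number minus one.
  have hle := unmatchedCount_le hp (Nat.le_add_right p l.length) (Nat.le_succ _)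
  rw [hu, Nat.succ_eq_add_one, hh, hc0, hcl] at hle
  push_cast at hle
  linarith

end Desubstitution

/-! ### The infimax sequence is the limit sequence. -/

section LowerBound

variable {m : ℕ}

theorem J_spec {α : Fin (m + 2) → ℝ} (h : α ∈ Delta (m + 2)) :
    0 < (J α + 1) * α (Fin.last (m + 1)) - α 0 := by
  have hl := h.2.1
  rw [lst_eq] at hl
  have := Nat.lt_floor_add_one (α 0 / α (Fin.last (m + 1)))
  rw [div_lt_iff₀ hl] at this
  rw [J, fst_eq, lst_eq]
  linarith

/-- The height grows at the rate `(n + 1) * α (Fin.last (m + 1)) - α 0`, and the unmatched count is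
caught between the least future height and the height itself, up to constants. -/
theorem subLin_unmatchedCount {n : ℕ} {w : ℕ → Fin (m + 2)} {α : Fin (m + 2) → ℝ}
    (hw : toLex w ∈ sequencesWithProportions α)
    (hc : 0 < (n + 1) * α (Fin.last (m + 1)) - α 0)
    (hrun : ∀ q, w q = Fin.last (m + 1) → ∀ i < n, w (q + 1 + i) = 0) :
    SubLin fun t => (unmatchedCount n w t : ℝ) - t * ((n + 1) * α (Fin.last (m + 1)) - α 0) := by
  rw [mem_sequencesWithProportions_iff] at hw
  set c := (n + 1) * α (Fin.last (m + 1)) - α 0 with hcdef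
  have hh : SubLin fun t => (height n w t : ℝ) - t * c := by
    convert ((hw (Fin.last (m + 1))).const_mul (n + 1)).sub (hw 0) using 2 with t
    simp only [height, counts, hcdef]
    push_cast; ring
  have hlow : ∀ ε > 0, ∃ C, ∀ t : ℕ, (t : ℝ) * c - ε * t - C ≤ unmatchedCount n w t := by
    intro ε hε
    -- Truncating `ε` at `c` keeps the slope `c - min ε c` nonnegative, so the bound at time `t`
    -- persists at all later times, as `le_unmatchedCount` requires.
    obtain ⟨C, hC⟩ := hh (min ε c) (lt_min hε hc)
    refine ⟨C + 1, fun t => ?_⟩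
    have h1 : (t : ℝ) * c - ε * t ≤ (c - min ε c) * t := by
      have := mul_le_mul_of_nonneg_right (min_le_left ε c) (Nat.cast_nonneg (α := ℝ) t)
      linarith
    rcases le_or_gt ((c - min ε c) * t - C) 0 with h0 | h0
    · have : (0 : ℝ) ≤ unmatchedCount n w t := Nat.cast_nonneg _
      linarith
    have h2 : ⌊(c - min ε c) * t - C⌋₊ ≤ unmatchedCount n w t := by
      refine le_unmatchedCount hrun _ t fun s hs => ?_
      have h3 := (abs_le.1 (hC s)).1
      have h4 : (c - min ε c) * t ≤ (c - min ε c) * s :=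
        mul_le_mul_of_nonneg_left (Nat.cast_le.2 hs) (by linarith [min_le_right ε c])
      have h5 := Nat.floor_le h0.le
      have h6 : ((⌊(c - min ε c) * t - C⌋₊ : ℤ) : ℝ) ≤ (height n w s : ℝ) := by
        push_cast
        linarith
      exact_mod_cast h6
    have h3 := Nat.lt_floor_add_one ((c - min ε c) * t - C)
    have h4 : ((⌊(c - min ε c) * t - C⌋₊ : ℕ) : ℝ) ≤ unmatchedCount n w t := Nat.cast_le.2 h2
    linarith
  obtain ⟨p, hp⟩ : ∃ p, Unmatched n w p := by
    by_contra hno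
    push Not at hno
    have h0 : ∀ t, unmatchedCount n w t = 0 := by
      intro t
      induction t with
      | zero => simp [unmatchedCount]
      | succ t ih => rw [unmatchedCount_succ_of_not t (hno t), ih]
    obtain ⟨C, hC⟩ := hlow (c / 2) (by linarith)
    obtain ⟨t, ht⟩ := exists_nat_gt (C / (c / 2))
    rw [div_lt_iff₀ (by linarith)] at ht
    have := hC t
    rw [h0] at this
    push_cast at this
    linarith
  intro ε hε
  obtain ⟨C, hC⟩ := hlow ε hε
  obtain ⟨D, hD⟩ := hh ε hε
  refine ⟨|C| + |D| + unmatchedCount n w p + |(height n w p : ℝ)|, fun t => ?_⟩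
  have hu : (0 : ℝ) ≤ unmatchedCount n w p := Nat.cast_nonneg _
  have h1 := le_abs_self C
  have h2 := le_abs_self D
  have h3 := neg_abs_le (height n w p : ℝ)
  have h4 := abs_nonneg C
  have h5 := abs_nonneg D
  have h6 := abs_nonneg (height n w p : ℝ)
  have h7 := (abs_le.1 (hD t)).2
  have h8 := hC t
  have h9 : 0 ≤ ε * t := by positivity
  have h10 : 0 ≤ t * c := by positivity
  rw [abs_le]
  refine ⟨by linarith, ?_⟩
  rcases le_or_gt p t with hpt | hpt
  · have := unmatchedCount_le hp hpt le_rfl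
    have h11 : (unmatchedCount n w t : ℝ) - unmatchedCount n w p ≤
        height n w t - height n w p := by exact_mod_cast this
    linarith
  · have h11 : (unmatchedCount n w t : ℝ) ≤ unmatchedCount n w p :=
      Nat.cast_le.2 (unmatchedCount_mono hpt.le)
    linarith

theorem nzCount_eq_sub_counts_zero (w : ℕ → Fin (m + 2)) (t : ℕ) :
    (nzCount w t : ℝ) = t - counts (pre w t) 0 := by
  induction t with
  | zero => simp [nzCount]
  | succ t ih =>
    rw [pre_succ, counts_append, counts_singleton, Pi.add_apply]
    by_cases h : w t = 0
    · rw [nzCount_succ_of_not h, ih, h]; push_cast; simp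
    · rw [nzCount_succ_of h]; push_cast; rw [ih, Pi.single_eq_of_ne (Ne.symm h)]; ring

theorem desub_mem {w : ℕ → Fin (m + 2)} {α : Fin (m + 2) → ℝ} (hα : α ∈ Delta (m + 2))
    (hw : toLex w ∈ sequencesWithProportions α)
    (hrun : ∀ q, w q = Fin.last (m + 1) → ∀ i < J α, w (q + 1 + i) = 0) :
    (∀ j, ∃ p, w p ≠ 0 ∧ nzCount w p = j) ∧
      toLex (desub (J α) w) ∈ sequencesWithProportions (K α) := by
  set n := J α with hn
  have hu := subLin_unmatchedCount hw (J_spec hα) hrun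
  rw [mem_sequencesWithProportions_iff] at hw
  have hα0 : 0 < 1 - α 0 := by linarith [coord_zero_lt_one hα]
  have hz : SubLin fun t => (nzCount w t : ℝ) - t * (1 - α 0) := by
    convert (hw 0).const_mul (-1) using 2 with t
    rw [nzCount_eq_sub_counts_zero]; ring
  obtain ⟨C, hC⟩ := hz ((1 - α 0) / 2) (by linarith)
  have hC' : ∀ t : ℕ, t * ((1 - α 0) / 2) ≤ nzCount w t + C := fun t => by
    have := (abs_le.1 (hC t)).1
    linarith
  have hinf : {s | w s ≠ 0}.Infinite := by
    intro hfin
    obtain ⟨t, ht⟩ := exists_nat_gt (((hfin.toFinset.card : ℝ) + C) / ((1 - α 0) / 2))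
    rw [div_lt_iff₀ (by linarith)] at ht
    have h1 : nzCount w t ≤ hfin.toFinset.card := by
      rw [nzCount, Nat.count_eq_card_filter_range]
      exact Finset.card_le_card fun s hs => hfin.mem_toFinset.2 (Finset.mem_filter.1 hs).2
    have h2 : (nzCount w t : ℝ) ≤ hfin.toFinset.card := Nat.cast_le.2 h1
    linarith [hC' t]
  let pos : ℕ → ℕ := Nat.nth fun s => w s ≠ 0
  have hpos : ∀ j, nzCount w (pos j) = j := fun j =>
    Nat.count_nth_of_infinite (p := fun s => w s ≠ 0) hinf j
  refine ⟨fun j => ⟨pos j, Nat.nth_mem_of_infinite hinf j, hpos j⟩, ?_⟩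
  -- Passing from positions in `w` to indices of nonzero letters divides densities by `1 - α 0`, the
  -- normalization of `K`. The linear bound on `pos j` keeps errors sublinear.
  have key : ∀ (f : ℕ → ℝ) (a : ℝ), SubLin (fun t => f t - t * a) →
      SubLin fun j => f (pos j) - j * ((1 - α 0)⁻¹ * a) := by
    intro f a hf
    have h1 := (hf.sub (hz.const_mul ((1 - α 0)⁻¹ * a))).comp (p := pos)
      (a := ((1 - α 0) / 2)⁻¹) (b := ((1 - α 0) / 2)⁻¹ * C) (by positivity) fun j => by
        have := hC' (pos j)
        rw [hpos] at this
        rw [← mul_add, inv_mul_eq_div, le_div_iff₀ (by linarith)]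
        exact this
    convert h1 using 2 with j
    rw [hpos]
    field_simp
    ring
  rw [mem_sequencesWithProportions_iff]
  intro i
  rw [K, Kn_eq, ← hn]
  simp only [Pi.smul_apply, smul_eq_mul]
  rcases index_cases' i with rfl | rfl | ⟨l, hl, rfl⟩
  · rw [abelInv_penult]
    have h1 := (hw (Fin.last (m + 1))).sub hu
    convert key (fun t => counts (pre w t) (Fin.last (m + 1)) - unmatchedCount n w t)
      (α 0 - n * α (Fin.last (m + 1))) ?_ using 2 with j
    · have := counts_desub_penult (n := n) (w := w) (pos j)
      rw [hpos] at this
      simp only [counts]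
      rw [← this]; push_cast; ring
    · convert h1 using 2
      ring
  · rw [abelInv_last]
    convert key (fun t => (unmatchedCount n w t : ℝ)) _ hu using 2 with j
    have := counts_desub_last (n := n) (w := w) (pos j)
    rw [hpos] at this
    rw [counts, this]
  · rw [abelInv_mid _ _ _ hl]
    have hl' : l + 1 < m + 2 := by omega
    convert key (fun t => counts (pre w t) ⟨l + 1, hl'⟩) (α ⟨l + 1, hl'⟩) (hw ⟨l + 1, hl'⟩)
      using 2 with j
    have := counts_desub_mid (n := n) (w := w) l hl (pos j)
    rw [hpos] at this
    rw [counts, counts, this]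

theorem lam_lt_of_short_run {n : ℕ} {w x : ℕ → Fin (m + 2)} (hx : x 0 = Fin.last (m + 1))
    (hw : w 0 = Fin.last (m + 1)) (h : ∃ i < n, w (1 + i) ≠ 0) : toLex (lam n x) < toLex w := by
  have hex : ∃ i, w (1 + i) ≠ 0 := h.imp fun _ h => h.2
  obtain ⟨i, hi, hwi⟩ := h
  classical
  have hlt : Nat.find hex < n := (Nat.find_min' hex hwi).trans_lt hi
  have hz : ∀ j < n, lam n x (j + 1) = 0 := fun j hj =>
    lam_apply_succ_of_lt _ _ (by simpa [hx, zs] using hj)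
  refine toLex_lt_iff.2 ⟨Nat.find hex + 1, fun j hj => ?_, ?_⟩
  · rcases j with _ | j
    · rw [lam_zero, hx, hw, hd_last]
    · rw [hz j (by omega), ← not_not.1 (Nat.find_min hex (m := j) (by omega)), add_comm 1 j]
  · rw [hz _ hlt, add_comm _ 1]
    exact Fin.pos_of_ne_zero (Nat.find_spec hex)

/-- Some tail of every sequence with proportions `α` is at least the image under the
substitutions of the least sequence that starts with the largest letter. -/
theorem exists_Lam_le_tail (r : ℕ) {α : Fin (m + 2) → ℝ} (hα : α ∈ Delta (m + 2))
    {w : ℕ → Fin (m + 2)} (hw : toLex w ∈ sequencesWithProportions α) :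
    ∃ i, toLex (Lam (Phi α) r (scons (Fin.last (m + 1)) fun _ => 0)) ≤ toLex (tail i w) := by
  induction r generalizing α w with
  | zero =>
    -- The largest letter occurs because its proportion is positive, and the least sequence
    -- beginning with it continues with zeros only.
    obtain ⟨q, hq⟩ : ∃ q, w q = Fin.last (m + 1) := by
      by_contra hno
      push Not at hno
      rw [mem_sequencesWithProportions_iff] at hw
      have h1 : Tendsto (fun t : ℕ => (0 : ℝ) / t) atTop (𝓝 (α (Fin.last (m + 1)))) := by
        refine (subLin_iff_tendsto (f := fun _ => 0)).1 ?_
        convert hw (Fin.last (m + 1)) using 3 with t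
        have : (pre w t).count (Fin.last (m + 1)) = 0 := by
          rw [List.count_eq_zero]
          simp only [pre, List.mem_map, not_exists, not_and]
          exact fun s _ => hno s
        rw [counts, this, Nat.cast_zero]
      simp only [zero_div] at h1
      have h2 := tendsto_nhds_unique h1 tendsto_const_nhds
      have h3 := hα.2.1
      rw [lst_eq, h2] at h3
      exact lt_irrefl _ h3
    refine ⟨q, not_lt.1 fun hlt => ?_⟩
    obtain ⟨t, -, ht⟩ := toLex_lt_iff.1 hlt
    rcases t with _ | t
    · simp [hq, Lam] at ht
    · simp [Lam] at ht
  | succ r ih =>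
    set T := Lam (Phi (K α)) r (scons (Fin.last (m + 1)) fun _ => 0) with hT
    have hT0 : T 0 = Fin.last (m + 1) := Lam_zero_of_last _ _ rfl
    rw [Lam_succ', tail_Phi, Phi_zero, ← hT]
    -- If some largest letter is followed by fewer than `J α` zeros, the tail from it is already
    -- larger than any image starting with the largest letter. Otherwise `w` desubstitutes, and a
    -- tail of `desub (J α) w` supplied by induction starts with the largest letter, hence at an
    -- unmatched position.
    by_cases hrun : ∀ q, w q = Fin.last (m + 1) → ∀ i < J α, w (q + 1 + i) = 0
    · obtain ⟨hsurj, hv⟩ := desub_mem hα hw hrun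
      obtain ⟨j, hj⟩ := ih (K_mem hα) hv
      obtain ⟨p, hp, rfl⟩ := hsurj j
      have h0 : desub (J α) w (nzCount w p) = Fin.last (m + 1) := by
        have := zero_le_of_le hj
        rw [← hT, hT0, tail_apply, add_zero] at this
        exact le_antisymm (Fin.le_last _) this
      rw [desub_nzCount hp] at h0
      have hun : Unmatched (J α) w p := by
        by_contra hun
        simp only [code, hun, if_false] at h0
        have := (w p).isLt
        split_ifs at h0 with h1
        · exact penult_ne_last h0
        · simp only [Fin.ext_iff, Fin.val_last] at h0 h1
          omega
      exact ⟨p, (lam_mono _ hj).trans (lam_desub_le hun)⟩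
    · push Not at hrun
      obtain ⟨q, hq, i, hi, hne⟩ := hrun
      exact ⟨q, (lam_lt_of_short_run hT0 (by simpa using hq) ⟨i, hi, by
        rw [tail_apply, ← add_assoc]; exact hne⟩).le⟩

theorem isGLB_limSeq {α : Fin (m + 2) → ℝ} (hα : α ∈ Delta (m + 2)) :
    IsGLB (maximalSequences α) (toLex (limSeq (Phi α))) := by
  constructor
  · rintro w ⟨hmax, hw⟩
    obtain ⟨w, rfl⟩ := toLex.surjective w
    refine limSeq_le_of_Lam_le _ (x := scons (Fin.last (m + 1)) fun _ => 0) fun r => ?_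
    obtain ⟨i, hi⟩ := exists_Lam_le_tail r hα hw
    exact hi.trans (isMaximalSeq_iff.1 hmax i)
  · intro w hw
    obtain ⟨w, rfl⟩ := toLex.surjective w
    refine le_limSeq_of_le_Lam _ fun r => ?_
    obtain ⟨x, hx⟩ := exists_Lam_mem_maximalSequences r hα
    exact ⟨x, hw hx⟩

theorem isLeast_infimax_iff {α : Fin (m + 2) → ℝ} (hα : α ∈ Delta (m + 2)) :
    IsLeast (maximalSequences α) (infimax α) ↔
      toLex (limSeq (Phi α)) ∈ sequencesWithProportions α := by
  have e : infimax α = toLex (limSeq (Phi α)) := (isGLB_infimax α).unique (isGLB_limSeq hα)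
  rw [e]
  exact ⟨fun h => h.1.2, fun h => ⟨⟨limSeq_isMaximal _, h⟩, (isGLB_limSeq hα).1⟩⟩

end LowerBound

/-! ### The fibre as the base of an intersection of simplicial cones. -/

section Fibre

variable {m : ℕ}

/-- The vectors with coordinate sum `1` to which the unnormalized continued fraction maps for the
sequence `n` can be applied forever without leaving the nonnegative orthant. -/
def polytope (m : ℕ) (n : ℕ → ℕ) : Set (Fin (m + 2) → ℝ) :=
  {β | ∑ i, β i = 1 ∧ ∀ r i, 0 ≤ (AbelEquiv n r).symm β i}

theorem AbelEquiv_symm_eq (n : ℕ → ℕ) (r : ℕ) (β : Fin (m + 2) → ℝ) :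
    (AbelEquiv n r).symm β = abel (n r) ((AbelEquiv n (r + 1)).symm β) := by
  rw [AbelEquiv_succ_symm, ← abelEquiv_symm_apply, ← abelEquiv_apply,
    LinearEquiv.apply_symm_apply]

/-- If the last coordinate vanished at one stage, the last two would vanish at all following stages,
hence also the first; the shift of the middle coordinates then spreads the zeros to the whole
vector, against the coordinate sum `1`. -/
theorem last_pos_of_mem_polytope {n : ℕ → ℕ} {β : Fin (m + 2) → ℝ} (h : β ∈ polytope m n)
    (r : ℕ) : 0 < (AbelEquiv n r).symm β (Fin.last (m + 1)) := by
  refine lt_of_le_of_ne (h.2 r _) fun h0 => ?_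
  set b : ℕ → Fin (m + 2) → ℝ := fun r => (AbelEquiv n r).symm β with hb
  have hrec : ∀ s, b s = abel (n s) (b (s + 1)) := fun s => AbelEquiv_symm_eq n s β
  have hnext : ∀ s, b s (Fin.last (m + 1)) = 0 →
      b (s + 1) (penult m) = 0 ∧ b (s + 1) (Fin.last (m + 1)) = 0 := by
    intro s hs
    rw [hrec, abel_last] at hs
    have h1 := h.2 (s + 1) (penult m)
    have h2 := h.2 (s + 1) (Fin.last (m + 1))
    change 0 ≤ b (s + 1) _ at h1 h2
    constructor <;> linarith
  have hlast : ∀ s, r ≤ s → b s (Fin.last (m + 1)) = 0 := by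
    intro s hs
    induction s, hs using Nat.le_induction with
    | base => exact h0.symm
    | succ s _ ih => exact (hnext s ih).2
  have hall : ∀ i, ∀ hi : i ≤ m, ∀ s, r ≤ s → b s ⟨i, by omega⟩ = 0 := by
    intro i
    induction i with
    | zero =>
      intro hi s hs
      obtain ⟨h1, h2⟩ := hnext s (hlast s hs)
      change b s 0 = 0
      rw [hrec, abel_zero, h1, h2]; ring
    | succ i ih =>
      intro hi s hs
      rw [hrec, abel_mid _ _ _ (by omega)]
      exact ih (by omega) (s + 1) (by omega)
  have hz : b r = 0 := by
    funext i
    rcases Nat.lt_or_ge i.val (m + 1) with hi | hi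
    · exact hall i.val (by omega) r le_rfl
    · have : i = Fin.last (m + 1) := by ext; simp; omega
      rw [this]; exact h0.symm
  have hβ : β = 0 := by simpa [hb] using hz
  have := h.1
  simp [hβ] at this

theorem iterate_K_mem {α : Fin (m + 2) → ℝ} (h : α ∈ Delta (m + 2)) (r : ℕ) :
    K^[r] α ∈ Delta (m + 2) := (mapsTo_K (by omega)).iterate r h

theorem abelInv_eq_smul_K {α : Fin (m + 2) → ℝ} (h : α ∈ Delta (m + 2)) :
    abelInv (J α) α = (1 - α 0) • K α := by
  rw [K, Kn_eq, smul_smul, mul_inv_cancel₀ (by linarith [coord_zero_lt_one h]), one_smul]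

/-- Iterating `K` and iterating `abelInv` give the same vectors up to positive scalars. The floor
`J` is the only `n` for which the two new coordinates are nonnegative and positive respectively; the
polytope imposes only the weak inequalities, and strictness of the second is automatic. -/
theorem fibre_eq (α : Fin (m + 2) → ℝ) : fibre α = polytope m (Phi α) := by
  ext β
  have hsmul : ∀ (n : ℕ) (s : ℝ) (b : Fin (m + 2) → ℝ), abelInv n (s • b) = s • abelInv n b :=
    fun n s b => by rw [← abelEquiv_symm_apply, map_smul]; rfl
  constructor
  · rintro ⟨hβ, hΦ⟩
    have key : ∀ r, ∃ s > (0 : ℝ), (AbelEquiv (Phi α) r).symm β = s • K^[r] β := by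
      intro r
      induction r with
      | zero => exact ⟨1, one_pos, by simp [AbelEquiv]⟩
      | succ r ih =>
        obtain ⟨s, hs, e⟩ := ih
        have hr := iterate_K_mem hβ r
        refine ⟨s * (1 - K^[r] β 0), mul_pos hs (by linarith [coord_zero_lt_one hr]), ?_⟩
        rw [AbelEquiv_succ_symm, e, hsmul, ← hΦ, Phi, abelInv_eq_smul_K hr, smul_smul,
          Function.iterate_succ_apply']
    refine ⟨hβ.2.2, fun r i => ?_⟩
    obtain ⟨s, hs, e⟩ := key r
    rw [e]
    exact mul_nonneg hs.le ((iterate_K_mem hβ r).1 i)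
  · intro h
    have hβ : β ∈ Delta (m + 2) := ⟨h.2 0, last_pos_of_mem_polytope h 0, h.1⟩
    have hJ : ∀ r, ∀ s > (0 : ℝ), (AbelEquiv (Phi α) r).symm β = s • K^[r] β →
        J (K^[r] β) = Phi α r := by
      intro r s hs e
      have h1 := h.2 (r + 1) (penult m)
      have h2 := last_pos_of_mem_polytope h (r + 1)
      rw [AbelEquiv_succ_symm, e, hsmul, Pi.smul_apply, smul_eq_mul] at h1 h2
      rw [abelInv_penult] at h1
      rw [abelInv_last] at h2
      have h3 := nonneg_of_mul_nonneg_right h1 hs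
      have h4 := (mul_pos_iff_of_pos_left hs).1 h2
      have hl := (iterate_K_mem hβ r).2.1
      rw [lst_eq] at hl
      rw [J, fst_eq, lst_eq, Nat.floor_eq_iff (div_nonneg ((iterate_K_mem hβ r).1 _) hl.le),
        le_div_iff₀ hl, div_lt_iff₀ hl]
      constructor <;> linarith
    have key : ∀ r, ∃ s > (0 : ℝ), (AbelEquiv (Phi α) r).symm β = s • K^[r] β := by
      intro r
      induction r with
      | zero => exact ⟨1, one_pos, by simp [AbelEquiv]⟩
      | succ r ih =>
        obtain ⟨s, hs, e⟩ := ih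
        have hr := iterate_K_mem hβ r
        refine ⟨s * (1 - K^[r] β 0), mul_pos hs (by linarith [coord_zero_lt_one hr]), ?_⟩
        rw [AbelEquiv_succ_symm, e, hsmul, ← hJ r s hs e, abelInv_eq_smul_K hr, smul_smul,
          Function.iterate_succ_apply']
    refine ⟨hβ, funext fun r => ?_⟩
    obtain ⟨s, hs, e⟩ := key r
    exact hJ r s hs e

theorem mem_fibre_self {α : Fin (m + 2) → ℝ} (h : α ∈ Delta (m + 2)) : α ∈ fibre α := ⟨h, rfl⟩

end Fibre

/-! ### Images of single letters, their recursion and their convergence. -/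

section Vertices

variable {m : ℕ}

/-- The letter counts of the image of the letter `i` under the substitutions `n 0, …, n (r - 1)`. -/
def vert (n : ℕ → ℕ) (r : ℕ) (i : Fin (m + 2)) : Fin (m + 2) → ℝ :=
  AbelEquiv n r (Pi.single i 1)

/-- The length of the image of the letter `i` under the substitutions `n 0, …, n (r - 1)`. -/
def vlen (n : ℕ → ℕ) (r : ℕ) (i : Fin (m + 2)) : ℝ := ∑ j, vert n r i j

variable (n : ℕ → ℕ) (r : ℕ)

theorem counts_LamW_singleton (i : Fin (m + 2)) : counts (LamW n r [i]) = vert n r i := by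
  rw [counts_LamW, counts_singleton]; rfl

theorem vlen_eq (i : Fin (m + 2)) : vlen n r i = (LamW n r [i]).length := by
  rw [vlen, ← counts_LamW_singleton, sum_counts]

theorem length_le_length_LamW (l : List (Fin (m + 2))) : l.length ≤ (LamW n r l).length := by
  induction r generalizing l with
  | zero => exact le_rfl
  | succ r ih =>
    refine le_trans ?_ (ih _)
    have := (strictMono_length_lamW (n r) (app l fun _ => 0)).le_apply (x := l.length)
    simpa only [pre_app_length] using this

theorem one_le_vlen (i : Fin (m + 2)) : 1 ≤ vlen n r i := by
  rw [vlen_eq]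
  exact_mod_cast length_le_length_LamW n r [i]

theorem vert_mid (j : ℕ) (hj : j < m) :
    vert (m := m) n (r + 1) ⟨j, by omega⟩ = vert n r ⟨j + 1, by omega⟩ := by
  rw [vert, AbelEquiv_succ_apply, vert, ← counts_singleton, ← counts_singleton, ← counts_blk]
  congr 2
  have h1 : zs (m := m) (n r) ⟨j, by omega⟩ = 0 := by simp [zs, hj.ne, (show j ≠ m + 1 by omega)]
  rw [blk, h1, List.replicate_zero]
  congr 1
  ext; simp [hd]; omega

theorem abel_single_last (a : ℕ) :
    abel a (Pi.single (Fin.last (m + 1)) (1 : ℝ)) = Pi.single (Fin.last (m + 1)) 1 +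
      (a : ℝ) • Pi.single 0 1 := by
  rw [← counts_singleton, ← counts_blk, blk, hd_last,
    show Fin.last (m + 1) :: List.replicate (zs a (Fin.last (m + 1))) 0 =
      [Fin.last (m + 1)] ++ List.replicate (zs a (Fin.last (m + 1))) 0 from rfl, counts_append]
  congr 1
  funext i
  by_cases hi : i = 0
  · simp [counts, zs, hi]
  · simp [counts, List.count_replicate, hi, Ne.symm hi]

theorem vert_last :
    vert (m := m) n (r + 1) (Fin.last (m + 1)) =
      vert n r (Fin.last (m + 1)) + (n r : ℝ) • vert n r 0 := by
  rw [vert, AbelEquiv_succ_apply, abel_single_last, map_add, map_smul]; rfl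

theorem vert_penult :
    vert (m := m) n (r + 1) (penult m) = vert n (r + 1) (Fin.last (m + 1)) + vert n r 0 := by
  rw [vert, AbelEquiv_succ_apply, vert, AbelEquiv_succ_apply, vert, ← map_add]
  congr 1
  rw [← counts_singleton, ← counts_singleton, ← counts_singleton, ← counts_blk, ← counts_blk,
    ← counts_append]
  congr 1
  have : hd (penult m) = hd (Fin.last (m + 1)) := by simp [hd]
  simp [blk, zs, this, List.replicate_succ']

theorem vert_eq_vert_zero (i : ℕ) (hi : i ≤ m) :
    vert (m := m) n r ⟨i, by omega⟩ = vert n (r + i) 0 := by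
  induction i generalizing r with
  | zero => rfl
  | succ i ih =>
    rw [← vert_mid _ _ _ (by omega), ih _ (by omega)]
    congr 1; omega

/-- The innermost `m` substitutions raise the letter `0` to the letter `m`, whose next image is that
of the largest letter followed by one `0`. -/
theorem vert_zero_add :
    vert (m := m) n (r + (m + 1)) 0 = vert n (r + 1) (Fin.last (m + 1)) + vert n r 0 := by
  rw [← vert_penult, show r + (m + 1) = r + 1 + m by omega, ← vert_eq_vert_zero _ _ m le_rfl]
  rfl

theorem vlen_zero_add :
    vlen (m := m) n (r + (m + 1)) 0 =
      vlen (m := m) n (r + 1) (Fin.last (m + 1)) + vlen (m := m) n r 0 := by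
  simp only [vlen, vert_zero_add, Pi.add_apply, Finset.sum_add_distrib]

theorem le_vlen_zero : (r : ℝ) ≤ (m + 1) * vlen (m := m) n r 0 := by
  induction r using Nat.strong_induction_on with
  | _ r ih =>
    rcases Nat.lt_or_ge r (m + 1) with h | h
    · have h1 := one_le_vlen (m := m) n r 0
      have h2 : (r : ℝ) ≤ m + 1 := by exact_mod_cast h.le
      have h3 : (0 : ℝ) ≤ m := Nat.cast_nonneg m
      nlinarith
    · obtain ⟨s, rfl⟩ := Nat.exists_eq_add_of_le' h
      have h1 := ih s (by omega)
      have h2 := one_le_vlen (m := m) n (s + 1) (Fin.last (m + 1))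
      have h3 : (0 : ℝ) ≤ m := Nat.cast_nonneg m
      rw [vlen_zero_add]
      push_cast
      nlinarith

theorem AbelEquiv_eq_sum (c : Fin (m + 2) → ℝ) : AbelEquiv n r c = ∑ i, c i • vert n r i := by
  conv_lhs => rw [pi_eq_sum_univ' c, map_sum]
  exact Finset.sum_congr rfl fun i _ => map_smul _ _ _

theorem sum_AbelEquiv (c : Fin (m + 2) → ℝ) :
    ∑ j, AbelEquiv n r c j = ∑ i, c i * vlen n r i := by
  rw [AbelEquiv_eq_sum]
  simp only [Finset.sum_apply, Pi.smul_apply, smul_eq_mul, vlen, Finset.mul_sum]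
  exact Finset.sum_comm

/-- If all vertices are nearly proportional to `γ`, so are their nonnegative combinations. -/
theorem abs_AbelEquiv_sub_le {n : ℕ → ℕ} {r : ℕ} {g ε : ℝ} {j : Fin (m + 2)}
    (h : ∀ i, |vert n r i j - vlen n r i * g| ≤ ε * vlen n r i) {c : Fin (m + 2) → ℝ}
    (hc : ∀ i, 0 ≤ c i) :
    |AbelEquiv n r c j - (∑ l, AbelEquiv n r c l) * g| ≤ ε * ∑ l, AbelEquiv n r c l := by
  have e : AbelEquiv n r c j - (∑ l, AbelEquiv n r c l) * g =
      ∑ i, c i * (vert n r i j - vlen n r i * g) := by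
    rw [sum_AbelEquiv, AbelEquiv_eq_sum, Finset.sum_mul]
    simp only [Finset.sum_apply, Pi.smul_apply, smul_eq_mul]
    rw [← Finset.sum_sub_distrib]
    exact Finset.sum_congr rfl fun i _ => by ring
  rw [e, sum_AbelEquiv, Finset.mul_sum]
  refine (Finset.abs_sum_le_sum_abs _ _).trans (Finset.sum_le_sum fun i _ => ?_)
  rw [abs_mul, abs_of_nonneg (hc i)]
  calc c i * _ ≤ c i * (ε * vlen n r i) := mul_le_mul_of_nonneg_left (h i) (hc i)
    _ = _ := by ring

/-- If the proportions of the images of the last letter converge, then so do those of the images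
of all letters, to the same limit. -/
theorem vert_converge {n : ℕ → ℕ} {g : ℝ} {j : Fin (m + 2)}
    (h : ∀ ε > 0, ∃ R, ∀ r ≥ R, |vert n r (Fin.last (m + 1)) j - vlen n r (Fin.last (m + 1)) * g| ≤
      ε * vlen n r (Fin.last (m + 1))) :
    ∀ ε > 0, ∃ R, ∀ r ≥ R, ∀ i, |vert n r i j - vlen n r i * g| ≤ ε * vlen n r i := by
  intro ε hε
  obtain ⟨R, hR⟩ := h (ε / 2) (by positivity)
  set d : ℕ → ℝ := fun r => vert n r 0 j - vlen (m := m) n r 0 * g with hd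
  set C := ∑ s ∈ Finset.range (R + (m + 1)), |d s| with hC
  -- The recursion adds the error of an image of the largest letter, which is at most `ε / 2` times
  -- the length added. So the initial errors, collected in `C`, never get amplified, and the growth
  -- of the lengths finally absorbs them.
  have hbound : ∀ r, |d r| ≤ ε / 2 * vlen (m := m) n r 0 + C := by
    intro r
    induction r using Nat.strong_induction_on with
    | _ r ih =>
      rcases Nat.lt_or_ge r (R + (m + 1)) with h | h
      · have h1 := Finset.single_le_sum (f := fun s => |d s|) (fun _ _ => abs_nonneg _)
          (Finset.mem_range.2 h)
        have h2 := one_le_vlen (m := m) n r 0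
        have h3 : 0 ≤ ε / 2 * vlen (m := m) n r 0 := by positivity
        linarith
      · obtain ⟨s, rfl⟩ := Nat.exists_eq_add_of_le' (show m + 1 ≤ r by omega)
        have h1 := ih s (by omega)
        have h2 := hR (s + 1) (by omega)
        have e : d (s + (m + 1)) = (vert n (s + 1) (Fin.last (m + 1)) j -
            vlen n (s + 1) (Fin.last (m + 1)) * g) + d s := by
          simp only [hd]
          rw [vert_zero_add, vlen_zero_add, Pi.add_apply]; ring
        rw [e, vlen_zero_add]
        refine (abs_add_le _ _).trans ?_
        linarith
  obtain ⟨R', hR'⟩ := exists_nat_gt ((m + 1) * C / (ε / 2))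
  have hzero : ∀ r ≥ R', |d r| ≤ ε * vlen (m := m) n r 0 := by
    intro r hr
    have h1 := le_vlen_zero (m := m) n r
    have h2 : (R' : ℝ) ≤ r := Nat.cast_le.2 hr
    rw [div_lt_iff₀ (by positivity)] at hR'
    have h3 : (m + 1) * C ≤ (m + 1) * (ε / 2 * vlen (m := m) n r 0) := by
      nlinarith
    have h4 := le_of_mul_le_mul_left h3 (by positivity)
    linarith [hbound r]
  refine ⟨max R R', fun r hr i => ?_⟩
  rcases Nat.lt_or_ge i.val (m + 1) with hi | hi
  · have e := vert_eq_vert_zero (m := m) n r i.val (by omega)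
    have e' : vlen n r i = vlen (m := m) n (r + i.val) 0 := by rw [vlen, vlen, ← e]
    have := hzero (r + i.val) (by have := le_max_right R R'; omega)
    rw [e']
    change |vert n r ⟨i.val, _⟩ j - _| ≤ _
    rw [e]
    exact this
  · have : i = Fin.last (m + 1) := by ext; simp; omega
    rw [this]
    refine (hR r (le_trans (le_max_left _ _) hr)).trans ?_
    have := one_le_vlen n r (Fin.last (m + 1))
    nlinarith

theorem polytope_subset_singleton {n : ℕ → ℕ} {γ : Fin (m + 2) → ℝ}
    (h : ∀ j, ∀ ε > 0, ∃ R, ∀ r ≥ R,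
      |vert n r (Fin.last (m + 1)) j - vlen n r (Fin.last (m + 1)) * γ j| ≤
        ε * vlen n r (Fin.last (m + 1))) : polytope m n ⊆ {γ} := by
  intro β hβ
  rw [Set.mem_singleton_iff]
  funext j
  refine eq_of_abs_sub_le_all fun ε hε => ?_
  obtain ⟨R, hR⟩ := vert_converge (h j) ε hε
  have := abs_AbelEquiv_sub_le (hR R le_rfl) (hβ.2 R)
  rwa [LinearEquiv.apply_symm_apply, hβ.1, one_mul, mul_one] at this

theorem exists_limit_of_mem {n : ℕ → ℕ} {α : Fin (m + 2) → ℝ}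
    (h : toLex (limSeq n) ∈ sequencesWithProportions α) :
    ∃ γ : Fin (m + 2) → ℝ, ∀ j, ∀ ε > 0, ∃ R, ∀ r ≥ R,
      |vert n r (Fin.last (m + 1)) j - vlen n r (Fin.last (m + 1)) * γ j| ≤
        ε * vlen n r (Fin.last (m + 1)) := by
  set len : ℕ → ℕ := fun r => (LamW n r [Fin.last (m + 1)]).length with hlen
  have hv : ∀ r, vlen n r (Fin.last (m + 1)) = len r := fun r => vlen_eq n r _
  have hrec : ∀ r, (len (r + 1) : ℝ) = len r + n r * vlen (m := m) n r 0 := by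
    intro r
    rw [← hv, ← hv]
    simp only [vlen, vert_last, Pi.add_apply, Finset.sum_add_distrib, Pi.smul_apply, smul_eq_mul,
      Finset.mul_sum]
  have hmono : Monotone len := by
    refine monotone_nat_of_le_succ fun r => ?_
    have h1 := hrec r
    have h2 : 0 ≤ n r * vlen (m := m) n r 0 :=
      mul_nonneg (Nat.cast_nonneg _) (by linarith [one_le_vlen (m := m) n r 0])
    have : (len r : ℝ) ≤ len (r + 1) := by linarith
    exact_mod_cast this
  -- If the lengths are unbounded, these images are arbitrarily long prefixes of `limSeq n` and
  -- inherit its proportions.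
  rcases tendsto_atTop_of_monotone hmono with hinf | ⟨l, hl⟩
  · refine ⟨α, fun j ε hε => ?_⟩
    rw [mem_sequencesWithProportions_iff] at h
    obtain ⟨C, hC⟩ := h j (ε / 2) (by positivity)
    obtain ⟨M, hM⟩ := exists_nat_gt (C / (ε / 2))
    rw [div_lt_iff₀ (by positivity)] at hM
    obtain ⟨R, hR⟩ := (tendsto_atTop.1 hinf M).exists_forall_of_atTop
    refine ⟨R, fun r hr => ?_⟩
    have hpre : pre (limSeq n) (len r) = LamW n r [Fin.last (m + 1)] := by
      have e : (limSeq (tail r n) : ℕ → Fin (m + 2)) =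
          app [Fin.last (m + 1)] (tail 1 (limSeq (tail r n))) := by
        rw [app_cons, app_nil, ← limSeq_zero (tail r n), scons_tail]
      rw [limSeq_eq_Lam n r, e, Lam_app, hlen, pre_app_length]
    have h1 := hC (len r)
    simp only [hpre, counts_LamW_singleton] at h1
    have h2 : (M : ℝ) ≤ len r := Nat.cast_le.2 (hR r hr)
    rw [hv]
    nlinarith
  -- If the lengths stabilize, then `n r = 0` from some point on and the count vector itself is
  -- eventually constant.
  · rw [nhds_discrete, tendsto_pure] at hl
    obtain ⟨R, hR⟩ := hl.exists_forall_of_atTop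
    have hconst : ∀ r ≥ R, vert n r (Fin.last (m + 1)) = vert n R (Fin.last (m + 1)) := by
      intro r hr
      induction r, hr using Nat.le_induction with
      | base => rfl
      | succ r hr ih =>
        have h1 := hrec r
        rw [hR r hr, hR (r + 1) (by omega)] at h1
        have h2 := one_le_vlen (m := m) n r 0
        have h3 : (n r : ℝ) = 0 := by
          have : (n r : ℝ) * vlen (m := m) n r 0 = 0 := by linarith
          rcases mul_eq_zero.1 this with h | h
          · exact h
          · linarith
        rw [vert_last, h3, zero_smul, add_zero, ih]
    refine ⟨(vlen n R (Fin.last (m + 1)))⁻¹ • vert n R (Fin.last (m + 1)), fun j ε hε =>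
      ⟨R, fun r hr => ?_⟩⟩
    have hp := one_le_vlen n R (Fin.last (m + 1))
    have e : vlen n r (Fin.last (m + 1)) = vlen n R (Fin.last (m + 1)) := by
      rw [vlen, hconst r hr]; rfl
    rw [hconst r hr, e, Pi.smul_apply, smul_eq_mul, mul_inv_cancel_left₀ (by positivity), sub_self,
      abs_zero]
    positivity

end Vertices

/-! ### Compactness of the approximating simplices, and part (b). -/

section Compactness

variable {m : ℕ}

/-- The vectors with coordinate sum `1` to which the first `r` unnormalized continued fraction
maps for `n` can be applied without leaving the nonnegative orthant. -/
def polytopeUpTo (m : ℕ) (n : ℕ → ℕ) (r : ℕ) : Set (Fin (m + 2) → ℝ) :=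
  {β | ∑ i, β i = 1 ∧ ∀ i, 0 ≤ (AbelEquiv n r).symm β i}

theorem polytopeUpTo_antitone (n : ℕ → ℕ) : Antitone (polytopeUpTo m n) :=
  fun _ _ hrs _ h => ⟨h.1, AbelEquiv_symm_nonneg_of_le n hrs h.2⟩

theorem iInter_polytopeUpTo (n : ℕ → ℕ) : ⋂ r, polytopeUpTo m n r = polytope m n := by
  ext β
  simp only [Set.mem_iInter, polytopeUpTo, polytope, Set.mem_ofPred_eq]
  exact ⟨fun h => ⟨(h 0).1, fun r => (h r).2⟩, fun h r => ⟨h.1, h.2 r⟩⟩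

theorem continuous_AbelEquiv_symm (n : ℕ → ℕ) (r : ℕ) :
    Continuous (AbelEquiv (m := m) n r).symm :=
  (AbelEquiv (m := m) n r).symm.toLinearMap.continuous_of_finiteDimensional

theorem isClosed_polytopeUpTo (n : ℕ → ℕ) (r : ℕ) : IsClosed (polytopeUpTo m n r) := by
  have h := continuous_AbelEquiv_symm (m := m) n r
  refine IsClosed.inter (isClosed_eq (by fun_prop) continuous_const) ?_
  have : {β | ∀ i, 0 ≤ (AbelEquiv (m := m) n r).symm β i} =
    ⋂ i, {β | 0 ≤ (AbelEquiv (m := m) n r).symm β i} := by ext; simp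
  change IsClosed {β | ∀ i, 0 ≤ (AbelEquiv (m := m) n r).symm β i}
  rw [this]
  exact isClosed_iInter fun i => isClosed_le continuous_const ((continuous_apply i).comp h)

theorem isCompact_polytopeUpTo (n : ℕ → ℕ) (r : ℕ) : IsCompact (polytopeUpTo m n r) := by
  refine (isCompact_Icc (a := (0 : Fin (m + 2) → ℝ)) (b := 1)).of_isClosed_subset
    (isClosed_polytopeUpTo n r) fun β hβ => ?_
  have h0 := (polytopeUpTo_antitone n (Nat.zero_le r) hβ).2
  refine ⟨fun i => h0 i, fun i => ?_⟩
  rw [Pi.one_apply, ← hβ.1]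
  exact Finset.single_le_sum (fun j _ => h0 j) (Finset.mem_univ i)

theorem vert_mem_polytopeUpTo (n : ℕ → ℕ) (r : ℕ) (i : Fin (m + 2)) :
    (vlen n r i)⁻¹ • vert n r i ∈ polytopeUpTo m n r := by
  have hp := one_le_vlen n r i
  refine ⟨?_, fun j => ?_⟩
  · simp only [Pi.smul_apply, smul_eq_mul, ← Finset.mul_sum]
    exact inv_mul_cancel₀ (by positivity)
  · rw [map_smul, vert, LinearEquiv.symm_apply_apply, Pi.smul_apply, smul_eq_mul, Pi.single_apply]
    split_ifs <;> positivity

/-- Nested compact sets with intersection `{α}` eventually lie in any ball around `α`, and the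
normalized letter images belong to them. -/
theorem exists_vert_near {n : ℕ → ℕ} {α : Fin (m + 2) → ℝ} (h : polytope m n = {α}) {ε : ℝ}
    (hε : 0 < ε) : ∃ r, ∀ i j, |vert n r i j - vlen n r i * α j| ≤ ε * vlen n r i := by
  obtain ⟨r, hr⟩ := exists_subset_nhds_of_isCompact' (V := polytopeUpTo m n)
    (polytopeUpTo_antitone n).directed_ge (isCompact_polytopeUpTo n) (isClosed_polytopeUpTo n)
    (U := Metric.ball α ε) (by
      rw [iInter_polytopeUpTo, h]
      rintro x rfl
      exact Metric.ball_mem_nhds _ hε)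
  refine ⟨r, fun i j => ?_⟩
  have hp := one_le_vlen n r i
  have h1 := (dist_le_pi_dist _ _ j).trans_lt (Metric.mem_ball.1 (hr (vert_mem_polytopeUpTo n r i)))
  rw [Real.dist_eq, Pi.smul_apply, smul_eq_mul] at h1
  have e : vert n r i j - vlen n r i * α j =
      vlen n r i * ((vlen n r i)⁻¹ * vert n r i j - α j) := by
    field_simp
  rw [e, abs_mul, abs_of_pos (by positivity), mul_comm]
  gcongr

/-- The limit sequence is a concatenation of the words `LamW n r [i]`, so for suitable `r` every
block has proportions within `ε` of `α`. -/
theorem limSeq_mem {n : ℕ → ℕ} {α : Fin (m + 2) → ℝ} (hα : α ∈ Delta (m + 2))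
    (h : polytope m n = {α}) : toLex (limSeq n) ∈ sequencesWithProportions α := by
  rw [mem_sequencesWithProportions_iff]
  intro j ε hε
  obtain ⟨r, hr⟩ := exists_vert_near h hε
  rw [limSeq_eq_Lam n r]
  refine subLin_of_blocks (W := LamW n r) (LamW_nil n r) (LamW_append n r)
    (fun a => length_le_length_LamW n r [a]) (Lam_app n r) hε (abs_le_one_of_mem hα j)
    ⟨0, fun N => ?_⟩
  rw [← sum_counts, counts_LamW, add_zero]
  exact abs_AbelEquiv_sub_le (fun i => hr i j) (counts_nonneg _)

theorem isLeast_infimax_iff_fibre {α : Fin (m + 2) → ℝ} (hα : α ∈ Delta (m + 2)) :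
    IsLeast (maximalSequences α) (infimax α) ↔ ∃ β, fibre α = {β} := by
  rw [isLeast_infimax_iff hα]
  constructor
  · intro h
    obtain ⟨γ, hγ⟩ := exists_limit_of_mem h
    have := polytope_subset_singleton hγ
    rw [← fibre_eq] at this
    exact ⟨γ, this.antisymm (by
      rw [← Set.mem_singleton_iff.1 (this (mem_fibre_self hα))]
      simpa using mem_fibre_self hα)⟩
  · rintro ⟨β, hβ⟩
    have : α = β := by
      have := mem_fibre_self hα
      rw [hβ] at this
      exact this
    subst this
    exact limSeq_mem hα (by rw [← fibre_eq, hβ])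

end Compactness

/-! ### Riesz decomposition, independence of extreme points, and part (a). -/

section Simplex

variable {m : ℕ}

/-- The cone over `polytope m n`. -/
def cone (m : ℕ) (n : ℕ → ℕ) : Set (Fin (m + 2) → ℝ) :=
  {v | ∀ r i, 0 ≤ (AbelEquiv n r).symm v i}

variable {n : ℕ → ℕ} {u v : Fin (m + 2) → ℝ}

theorem cone_add (hu : u ∈ cone m n) (hv : v ∈ cone m n) : u + v ∈ cone m n := fun r i => by
  rw [map_add]; exact add_nonneg (hu r i) (hv r i)

theorem cone_smul {c : ℝ} (hc : 0 ≤ c) (hv : v ∈ cone m n) : c • v ∈ cone m n := fun r i => by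
  rw [map_smul]; exact mul_nonneg hc (hv r i)

theorem cone_sum {ι : Type*} {s : Finset ι} {f : ι → Fin (m + 2) → ℝ}
    (h : ∀ j ∈ s, f j ∈ cone m n) : ∑ j ∈ s, f j ∈ cone m n := fun r i => by
  rw [map_sum, Finset.sum_apply]; exact Finset.sum_nonneg fun j hj => h j hj r i

theorem cone_nonneg (hv : v ∈ cone m n) (i) : 0 ≤ v i := hv 0 i

theorem cone_eq_zero (hv : v ∈ cone m n) (h : ∑ i, v i = 0) : v = 0 := by
  rw [Finset.sum_eq_zero_iff_of_nonneg fun i _ => cone_nonneg hv i] at h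
  funext i; exact h i (Finset.mem_univ i)

theorem cone_sum_nonneg (hv : v ∈ cone m n) : 0 ≤ ∑ i, v i :=
  Finset.sum_nonneg fun i _ => cone_nonneg hv i

theorem inv_smul_mem_polytope (hv : v ∈ cone m n) (h : 0 < ∑ i, v i) :
    (∑ i, v i)⁻¹ • v ∈ polytope m n := by
  refine ⟨?_, cone_smul (by positivity) hv⟩
  simp only [Pi.smul_apply, smul_eq_mul, ← Finset.mul_sum]
  exact inv_mul_cancel₀ h.ne'

/-- The cone has the Riesz decomposition property. -/
theorem cone_riesz {ι : Type*} [Fintype ι] {a : Fin (m + 2) → ℝ} {c : ι → Fin (m + 2) → ℝ}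
    (ha : a ∈ cone m n) (hc : ∀ j, c j ∈ cone m n) (hac : ∑ j, c j - a ∈ cone m n) :
    ∃ x : ι → Fin (m + 2) → ℝ, (∀ j, x j ∈ cone m n ∧ c j - x j ∈ cone m n) ∧ ∑ j, x j = a := by
  -- `F r` collects the decompositions that are valid for the simplicial cone of stage `r`. These
  -- sets are compact and decreasing, so it suffices that each be nonempty.
  let F : ℕ → Set (ι → Fin (m + 2) → ℝ) := fun r =>
    {x | (∀ j i, 0 ≤ (AbelEquiv n r).symm (x j) i ∧ 0 ≤ (AbelEquiv n r).symm (c j - x j) i) ∧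
      ∑ j, x j = a}
  have hanti : ∀ r s, r ≤ s → F s ⊆ F r := fun r s hrs x hx =>
    ⟨fun j i => ⟨AbelEquiv_symm_nonneg_of_le n hrs (fun i => (hx.1 j i).1) i,
      AbelEquiv_symm_nonneg_of_le n hrs (fun i => (hx.1 j i).2) i⟩, hx.2⟩
  have hclosed : ∀ r, IsClosed (F r) := by
    intro r
    have hcont := continuous_AbelEquiv_symm (m := m) n r
    have e : F r = (⋂ j, ⋂ i, ({x | 0 ≤ (AbelEquiv n r).symm (x j) i} ∩
        {x | 0 ≤ (AbelEquiv n r).symm (c j - x j) i})) ∩ {x | ∑ j, x j = a} := by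
      ext x; simp [F]
    rw [e]
    refine IsClosed.inter (isClosed_iInter fun j => isClosed_iInter fun i => IsClosed.inter ?_ ?_)
      (isClosed_eq (by fun_prop) continuous_const)
    · exact isClosed_le continuous_const
        ((continuous_apply i).comp (hcont.comp (continuous_apply j)))
    · exact isClosed_le continuous_const
        ((continuous_apply i).comp (hcont.comp (continuous_const.sub (continuous_apply j))))
  have hcompact : IsCompact (F 0) := by
    refine (isCompact_Icc (a := (0 : ι → Fin (m + 2) → ℝ)) (b := c)).of_isClosed_subset
      (hclosed 0) fun x hx => ⟨fun j i => (hx.1 j i).1, fun j i => ?_⟩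
    exact sub_nonneg.1 (hx.1 j i).2
  have hne : ∀ r, (F r).Nonempty := by
    intro r
    set A := AbelEquiv (m := m) n r
    set t : Fin (m + 2) → ℝ := fun i => ∑ j, A.symm (c j) i with ht
    have hat : ∀ i, A.symm a i ≤ t i := by
      intro i
      have := hac r i
      rw [map_sub, map_sum, Pi.sub_apply, Finset.sum_apply] at this
      linarith
    have h0 : ∀ i, 0 ≤ A.symm a i := ha r
    have h0c : ∀ j i, 0 ≤ A.symm (c j) i := fun j => hc j r
    have ht0 : ∀ i, 0 ≤ t i := fun i => (h0 i).trans (hat i)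
    have hle : ∀ i, A.symm a i / t i ≤ 1 := fun i => div_le_one_of_le₀ (hat i) (ht0 i)
    -- In the coordinates of stage `r` the cone is the orthant, where each coordinate of `a` is
    -- shared out in proportion to those of the `c j`. If `t i = 0`, the quotient is `0`, and so is
    -- that coordinate of `a`.
    refine ⟨fun j => A fun i => A.symm a i / t i * A.symm (c j) i, fun j i => ⟨?_, ?_⟩, ?_⟩
    · rw [LinearEquiv.symm_apply_apply]
      exact mul_nonneg (div_nonneg (h0 i) (ht0 i)) (h0c j i)
    · rw [map_sub, LinearEquiv.symm_apply_apply, Pi.sub_apply]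
      have := mul_le_mul_of_nonneg_right (hle i) (h0c j i)
      linarith
    · rw [← map_sum, ← LinearEquiv.eq_symm_apply]
      funext i
      rw [Finset.sum_apply, ← Finset.mul_sum]
      change A.symm a i / t i * t i = _
      rcases eq_or_ne (t i) 0 with h | h
      · have := hat i
        rw [h] at this ⊢
        rw [mul_zero, le_antisymm this (h0 i)]
      · exact div_mul_cancel₀ _ h
  obtain ⟨x, hx⟩ := IsCompact.nonempty_iInter_of_sequence_nonempty_isCompact_isClosed F
    (fun r => hanti r (r + 1) (Nat.le_succ r)) hne hcompact hclosed
  rw [Set.mem_iInter] at hx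
  exact ⟨x, fun j => ⟨fun r i => ((hx r).1 j i).1, fun r i => ((hx r).1 j i).2⟩, (hx 0).2⟩

/-- Normalizing both summands of `c • e = x + (c • e - x)` writes `e` as a convex combination of two
points of the polytope, so extremality identifies `x` up to scale. The cases where a summand
vanishes are separate. -/
theorem eq_smul_of_le_extreme {e x : Fin (m + 2) → ℝ} (he : e ∈ (polytope m n).extremePoints ℝ)
    {c : ℝ} (hx : x ∈ cone m n) (hcx : c • e - x ∈ cone m n) : x = (∑ i, x i) • e := by
  set t := ∑ i, x i with ht
  have hsum : ∑ i, (c • e - x) i = c - t := by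
    simp [Finset.sum_sub_distrib, ← Finset.mul_sum, he.1.1, ht]
  have htc := cone_sum_nonneg hcx
  rw [hsum] at htc
  rcases htc.eq_or_lt with h0 | hpos
  · have h1 := cone_eq_zero hcx (hsum.trans h0.symm)
    rw [show t = c by linarith]
    exact (sub_eq_zero.1 h1).symm
  rcases (cone_sum_nonneg hx).eq_or_lt with h0 | htpos
  · rw [cone_eq_zero hx h0.symm, ht, ← h0, zero_smul]
  rw [← ht] at htpos
  have h1 := inv_smul_mem_polytope hx htpos
  have h2 := inv_smul_mem_polytope hcx (by rw [hsum]; exact hpos)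
  rw [hsum] at h2
  rw [← ht] at h1
  have hc : 0 < c := by linarith
  have h3 := he.2 h1 h2 ⟨t / c, (c - t) / c, by positivity, by positivity, by field_simp; ring, by
    rw [smul_smul, smul_smul, show t / c * t⁻¹ = c⁻¹ by field_simp,
      show (c - t) / c * (c - t)⁻¹ = c⁻¹ by field_simp, ← smul_add, add_sub_cancel,
      inv_smul_smul₀ hc.ne']⟩
  rw [← h3, smul_inv_smul₀ htpos.ne']

/-- Suppose a relation has a positive coefficient at `e`. Then `g e • e` is dominated in the cone by
the terms with negative coefficients, and Riesz decomposition gives a nonzero vector below multiples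
of both `e` and some such `j`. It is proportional to both, so `j = e`, although the signs of their
coefficients differ. -/
theorem linearIndependent_extremePoints :
    LinearIndependent ℝ (Subtype.val : (polytope m n).extremePoints ℝ → Fin (m + 2) → ℝ) := by
  classical
  rw [linearIndependent_iff']
  have key : ∀ (s : Finset ((polytope m n).extremePoints ℝ)) (g : _ → ℝ),
      ∑ i ∈ s, g i • i.val = 0 → ∀ i ∈ s, g i ≤ 0 := by
    intro s g hg e he
    by_contra hpos
    rw [not_le] at hpos
    have hmem : ∀ i : (polytope m n).extremePoints ℝ, i.val ∈ cone m n := fun i => i.2.1.2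
    have hac : ∑ j : s, max (-g j) 0 • j.val.val - g e • e.val ∈ cone m n := by
      have h1 : ∑ j : s, max (-g j) 0 • j.val.val = ∑ j ∈ s, max (g j) 0 • j.val := by
        rw [Finset.sum_coe_sort s fun j => max (-g j) 0 • j.val, ← sub_eq_zero,
          ← Finset.sum_sub_distrib, ← neg_eq_zero, ← Finset.sum_neg_distrib, ← hg]
        refine Finset.sum_congr rfl fun j _ => ?_
        rw [← sub_smul, ← neg_smul]
        congr 1
        rcases le_total (g j) 0 with h | h
        · rw [max_eq_left (by linarith), max_eq_right h]; ring
        · rw [max_eq_right (by linarith), max_eq_left h]; ring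
      rw [h1, ← Finset.add_sum_erase _ _ he, max_eq_left hpos.le, add_sub_cancel_left]
      exact cone_sum fun j _ => cone_smul (le_max_right _ _) (hmem j)
    obtain ⟨x, hx, hxa⟩ := cone_riesz (cone_smul hpos.le (hmem e))
      (fun j : s => cone_smul (le_max_right (-g j) 0) (hmem j)) hac
    obtain ⟨j, hj⟩ : ∃ j, 0 < ∑ i, x j i := by
      by_contra hno
      push Not at hno
      have hz : ∀ j, x j = 0 := fun j =>
        cone_eq_zero (hx j).1 (le_antisymm (hno j) (cone_sum_nonneg (hx j).1))
      simp only [hz, Finset.sum_const_zero] at hxa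
      have h1 : ∑ i, (g e • e.val) i = g e := by
        simp [← Finset.mul_sum, e.2.1.1]
      rw [← hxa] at h1
      simp at h1
      exact hpos.ne h1
    have h1 := eq_smul_of_le_extreme j.val.2 (hx j).1 (hx j).2
    have h2 := eq_smul_of_le_extreme e.2 (c := g e) (hx j).1 (by
      rw [← hxa, ← Finset.add_sum_erase _ _ (Finset.mem_univ j), add_sub_cancel_left]
      exact cone_sum fun l _ => (hx l).1)
    have hje : j.val = e := by
      rw [h1] at h2
      have : (∑ i, x j i) • (j.val.val) = (∑ i, x j i) • e.val := by
        rw [← h1]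
        rw [← h1] at h2
        exact h2
      exact Subtype.ext (smul_right_injective _ hj.ne' this)
    have h3 := cone_sum_nonneg (hx j).2
    rw [hje, max_eq_right (by linarith), zero_smul, zero_sub] at h3
    simp only [Pi.neg_apply, Finset.sum_neg_distrib] at h3
    linarith
  intro s g hg i hi
  refine le_antisymm (key s g hg i hi) ?_
  have := key s (-g) (by simp [hg]) i hi
  simpa using this

/-- In the coordinates of stage `r` the determinant keeps its absolute value, by unimodularity. All
entries lie in `[0, 1]`, and those in row `0` are at most `1 / vlen n r 0`, hence `O(1 / r)`. -/
theorem det_eq_zero_of_mem_polytope {p : Fin (m + 2) → Fin (m + 2) → ℝ}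
    (hp : ∀ j, p j ∈ polytope m n) : (Matrix.of fun i j => p j i).det = 0 := by
  have hbound : ∀ r : ℕ, |(Matrix.of fun i j => p j i).det| * r ≤
      (Fintype.card (Equiv.Perm (Fin (m + 2)))) * (m + 1) := by
    intro r
    set Q : Matrix (Fin (m + 2)) (Fin (m + 2)) ℝ :=
      Matrix.of fun i j => (AbelEquiv n r).symm (p j) i with hQ
    have hPQ : (Matrix.of fun i j => p j i) =
        LinearMap.toMatrix' (AbelEquiv (m := m) n r).toLinearMap * Q := by
      ext i j
      have := congrFun (LinearMap.toMatrix'_mulVec (AbelEquiv (m := m) n r).toLinearMap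
        ((AbelEquiv n r).symm (p j))) i
      rw [LinearEquiv.coe_coe, LinearEquiv.apply_symm_apply] at this
      rw [Matrix.of_apply, ← this]
      rfl
    have hQ0 : ∀ i j, 0 ≤ Q i j := fun i j => (hp j).2 r i
    have hQs : ∀ j, ∑ i, Q i j * vlen n r i = 1 := by
      intro j
      rw [← (hp j).1, ← sum_AbelEquiv n r fun i => Q i j]
      exact Finset.sum_congr rfl fun i _ =>
        congrFun ((AbelEquiv n r).apply_symm_apply (p j)) i
    have hQ1 : ∀ i j, Q i j * vlen n r i ≤ 1 := by
      intro i j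
      rw [← hQs j]
      exact Finset.single_le_sum (f := fun i => Q i j * vlen n r i)
        (fun i _ => mul_nonneg (hQ0 i j) (by linarith [one_le_vlen n r i])) (Finset.mem_univ i)
    have hQle : ∀ i j, Q i j ≤ 1 := fun i j => by
      have := hQ1 i j
      have := one_le_vlen n r i
      have := hQ0 i j
      nlinarith
    have hQr : ∀ j, Q 0 j * r ≤ m + 1 := fun j => by
      have h1 := hQ1 0 j
      have h2 := mul_le_mul_of_nonneg_left (le_vlen_zero (m := m) n r) (hQ0 0 j)
      have h3 : (0 : ℝ) ≤ m + 1 := by positivity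
      nlinarith
    -- In each term of the Leibniz expansion only the factor from row `0`, found in column `σ⁻¹ 0`,
    -- is kept.
    have hdet : |Q.det| ≤ ∑ σ : Equiv.Perm (Fin (m + 2)), Q 0 (σ⁻¹ 0) := by
      rw [Matrix.det_apply']
      refine (Finset.abs_sum_le_sum_abs _ _).trans (Finset.sum_le_sum fun σ _ => ?_)
      have hsign : |((Equiv.Perm.sign σ : ℤ) : ℝ)| = 1 := by
        rcases Int.units_eq_one_or (Equiv.Perm.sign σ) with h | h <;> simp [h]
      rw [abs_mul, hsign, one_mul, abs_of_nonneg (Finset.prod_nonneg fun i _ => hQ0 _ _),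
        ← Finset.mul_prod_erase _ _ (Finset.mem_univ (σ⁻¹ 0))]
      have e : σ (σ⁻¹ 0) = 0 := by simp
      rw [e]
      exact mul_le_of_le_one_right (hQ0 _ _)
        (Finset.prod_le_one (fun i _ => hQ0 _ _) fun i _ => hQle _ _)
    rw [hPQ, Matrix.det_mul, LinearMap.det_toMatrix', abs_mul, AbelEquiv_det, one_mul]
    calc |Q.det| * r ≤ (∑ σ : Equiv.Perm (Fin (m + 2)), Q 0 (σ⁻¹ 0)) * r := by gcongr
      _ = ∑ σ : Equiv.Perm (Fin (m + 2)), Q 0 (σ⁻¹ 0) * r := Finset.sum_mul _ _ _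
      _ ≤ ∑ σ : Equiv.Perm (Fin (m + 2)), ((m : ℝ) + 1) := Finset.sum_le_sum fun σ _ => hQr _
      _ = _ := by rw [Finset.sum_const, nsmul_eq_mul, Finset.card_univ]
  by_contra hne
  have hpos := abs_pos.2 hne
  obtain ⟨r, hr⟩ := exists_nat_gt ((Fintype.card (Equiv.Perm (Fin (m + 2)))) * ((m : ℝ) + 1) /
    |(Matrix.of fun i j => p j i).det|)
  rw [div_lt_iff₀ hpos] at hr
  linarith [hbound r]

theorem polytope_isSimplex (hne : (polytope m n).Nonempty) :
    ∃ d, d ≤ m ∧ IsSimplexOfDim d (polytope m n) := by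
  have hcompact : IsCompact (polytope m n) := by
    rw [← iInter_polytopeUpTo]
    exact (isCompact_polytopeUpTo n 0).of_isClosed_subset
      (isClosed_iInter (isClosed_polytopeUpTo n)) (Set.iInter_subset _ 0)
  have hconvex : Convex ℝ (polytope m n) := by
    intro x hx y hy a b ha hb hab
    refine ⟨?_, cone_add (cone_smul ha hx.2) (cone_smul hb hy.2)⟩
    simp [Finset.sum_add_distrib, ← Finset.mul_sum, hx.1, hy.1, hab]
  have hli := linearIndependent_extremePoints (m := m) (n := n)
  have hfin : ((polytope m n).extremePoints ℝ).Finite := hli.setFinite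
  have hhull : convexHull ℝ ((polytope m n).extremePoints ℝ) = polytope m n := by
    -- Finitely many extreme points have a closed convex hull, so Krein–Milman needs no closure.
    rw [← (hfin.isClosed_convexHull ℝ).closure_eq]
    exact closure_convexHull_extremePoints hcompact hconvex
  have hEne := hcompact.extremePoints_nonempty hne
  let _ := hfin.fintype
  obtain ⟨d, hd⟩ : ∃ d, Fintype.card ((polytope m n).extremePoints ℝ) = d + 1 :=
    ⟨_, (Nat.succ_pred_eq_of_pos (Fintype.card_pos_iff.2 hEne.to_subtype)).symm⟩
  let e : Fin (d + 1) ≃ (polytope m n).extremePoints ℝ := (Fintype.equivFinOfCardEq hd).symm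
  have hle : d + 1 ≤ m + 2 := by
    have := hli.fintype_card_le_finrank
    simpa [hd] using this
  have hne' : d + 1 ≠ m + 2 := by
    intro heq
    obtain rfl : d = m + 1 := by omega
    have h1 := hli.comp e e.injective
    have h2 := det_eq_zero_of_mem_polytope (n := n) (p := fun j => (e j).val) fun j => (e j).2.1
    have h3 : IsUnit (Matrix.of fun i j => (e j).val i) :=
      Matrix.linearIndependent_cols_iff_isUnit.1 h1
    rw [Matrix.isUnit_iff_isUnit_det, h2] at h3
    exact not_isUnit_zero h3
  refine ⟨d, by omega, ⟨fun j => (e j).val, (hli.comp e e.injective).affineIndependent⟩, ?_⟩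
  refine hhull.symm.trans (congrArg _ ?_)
  change _ = Set.range (Subtype.val ∘ e)
  rw [e.surjective.range_comp, Subtype.range_coe]

end Simplex

end Infimax

theorem mainTheorem2 (k : ℕ) [NeZero k] (hk : 2 ≤ k) (α : Fin k → ℝ)
    (hα : α ∈ Infimax.Delta k) :
    (∃ d : ℕ, d ≤ k - 2 ∧ Infimax.IsSimplexOfDim d (Infimax.fibre α)) ∧
    (IsLeast (Infimax.maximalSequences α) (Infimax.infimax α) ↔
      ∃ β : Fin k → ℝ, Infimax.fibre α = {β}) := by
  obtain ⟨m, rfl⟩ : ∃ m, k = m + 2 := ⟨k - 2, by omega⟩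
  refine ⟨?_, Infimax.isLeast_infimax_iff_fibre hα⟩
  have h := Infimax.fibre_eq (m := m) α
  have hne : (Infimax.polytope m (Infimax.Phi α)).Nonempty := by
    rw [← h]; exact ⟨α, Infimax.mem_fibre_self hα⟩
  rw [Nat.add_sub_cancel]
  obtain ⟨d, hd, hs⟩ := Infimax.polytope_isSimplex hne
  rw [← h] at hs
  exact ⟨d, hd, hs⟩
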